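/- Let $m,n$ be non-negative integers with $m\ge n+1$. Let $\mathbb B^m$ be the closed unit ball of $\mathbb R^m$ centered at $0$, with boundary $\mathbb S^{m-1}$, both with the Euclidean distance. Let $\mathbb H^n$ be the Heisenberg group, that is, $\mathbb R^n\times\mathbb R^n\times\mathbb R$ with the group law $$(x,y,t)*(x',y',t')=\Big(x+x',\,y+y',\,t+t'+2\sum_{j=1}^n(y_jx_j'-x_jy_j')\Big)$$ and the Korányi metric $d_K(p,q)=\|q^{-1}*p\|_K$, where $\|(x,y,t)\|_K=(|(x,y)|^4+t^2)^{1/4}$. For $\alpha\in(0,1)$ write $f\in C^{0,\alpha+}(\mathbb B^m,\mathbb H^n)$ if $$\lim_{t\to0^+}\ \sup\Big\{\frac{d_K(f(x),f(y))}{|x-y|^{\alpha}}:\ x,y\in\mathbb B^m,\ 0<|x-y|\le t\Big\}=0.$$ Then there is no map $f\in C^{0,\frac{n+1}{n+2}+}(\mathbb B^m,\mathbb H^n)$ such that $f|_{\mathbb S^{m-1}}$ is a topological embedding. -/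

import Mathlib

open Filter Topology

noncomputable section

/-- The Heisenberg group `ℍⁿ`: the space `ℝⁿ × ℝⁿ × ℝ` with coordinates `(x, y, t)`. Its group law and
its metric are the instances below. -/
@[ext]
structure HeisenbergGroup (n : ℕ) where
  /-- the first `n` horizontal coordinates -/
  x : Fin n → ℝ
  /-- the last `n` horizontal coordinates -/
  y : Fin n → ℝ
  /-- the vertical coordinate -/
  t : ℝ

namespace HeisenbergGroup

variable {n : ℕ}

/-- The group law
`(x, y, t) * (x', y', t') = (x + x', y + y', t + t' + 2 ∑ (y_j x'_j - x_j y'_j))`. -/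
instance : Mul (HeisenbergGroup n) where
  mul p q := ⟨p.x + q.x, p.y + q.y, p.t + q.t + 2 * ∑ j, (p.y j * q.x j - p.x j * q.y j)⟩

instance : One (HeisenbergGroup n) where
  one := ⟨0, 0, 0⟩

instance : Inv (HeisenbergGroup n) where
  inv p := ⟨-p.x, -p.y, -p.t⟩

@[simp] theorem mul_x (p q : HeisenbergGroup n) : (p * q).x = p.x + q.x := rfl
@[simp] theorem mul_y (p q : HeisenbergGroup n) : (p * q).y = p.y + q.y := rfl
@[simp] theorem mul_t (p q : HeisenbergGroup n) :
    (p * q).t = p.t + q.t + 2 * ∑ j, (p.y j * q.x j - p.x j * q.y j) := rfl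
@[simp] theorem one_x : (1 : HeisenbergGroup n).x = 0 := rfl
@[simp] theorem one_y : (1 : HeisenbergGroup n).y = 0 := rfl
@[simp] theorem one_t : (1 : HeisenbergGroup n).t = 0 := rfl
@[simp] theorem inv_x (p : HeisenbergGroup n) : p⁻¹.x = -p.x := rfl
@[simp] theorem inv_y (p : HeisenbergGroup n) : p⁻¹.y = -p.y := rfl
@[simp] theorem inv_t (p : HeisenbergGroup n) : p⁻¹.t = -p.t := rfl

instance : Group (HeisenbergGroup n) :=
  Group.ofLeftAxioms
    (by
      intro p q r
      ext j
      · simp [add_assoc]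
      · simp [add_assoc]
      · simp only [mul_x, mul_y, mul_t, Pi.add_apply, Finset.mul_sum]
        have h : ∑ j, 2 * (p.y j * q.x j - p.x j * q.y j)
            + ∑ j, 2 * ((p.y j + q.y j) * r.x j - (p.x j + q.x j) * r.y j)
            = ∑ j, 2 * (q.y j * r.x j - q.x j * r.y j)
            + ∑ j, 2 * (p.y j * (q.x j + r.x j) - p.x j * (q.y j + r.y j)) := by
          rw [← Finset.sum_add_distrib, ← Finset.sum_add_distrib]
          exact Finset.sum_congr rfl fun j _ => by ring
        linarith)
    (by intro p; ext j <;> simp)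
    (by intro p; ext j <;> simp [mul_comm])

/-- The squared Euclidean length `|(x, y)|²` of the horizontal part. -/
def horizSq (p : HeisenbergGroup n) : ℝ := ∑ j, (p.x j ^ 2 + p.y j ^ 2)

/-- The Korányi norm `‖(x, y, t)‖_K = (|(x, y)|⁴ + t²)^{1/4}`. -/
def koranyiNorm (p : HeisenbergGroup n) : ℝ := (p.horizSq ^ 2 + p.t ^ 2) ^ (1 / 4 : ℝ)

theorem horizSq_nonneg (p : HeisenbergGroup n) : 0 ≤ p.horizSq :=
  Finset.sum_nonneg fun _ _ => by positivity

theorem koranyiNorm_nonneg (p : HeisenbergGroup n) : 0 ≤ p.koranyiNorm := by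
  unfold koranyiNorm; positivity

theorem koranyiNorm_inv (p : HeisenbergGroup n) : p⁻¹.koranyiNorm = p.koranyiNorm := by
  simp [koranyiNorm, horizSq]

theorem koranyiNorm_one : (1 : HeisenbergGroup n).koranyiNorm = 0 := by
  simp [koranyiNorm, horizSq]

theorem koranyiNorm_sq (p : HeisenbergGroup n) :
    p.koranyiNorm ^ 2 = ‖(⟨p.horizSq, p.t⟩ : ℂ)‖ := by
  have h0 : 0 ≤ p.horizSq ^ 2 + p.t ^ 2 := by positivity
  rw [Complex.norm_def, Complex.normSq_mk, koranyiNorm, ← Real.rpow_natCast, ← Real.rpow_mul h0,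
    Real.sqrt_eq_rpow, ← sq, ← sq]
  norm_num

theorem horizSq_le (p : HeisenbergGroup n) : p.horizSq ≤ p.koranyiNorm ^ 2 := by
  rw [koranyiNorm_sq]
  exact (le_abs_self _).trans (Complex.abs_re_le_norm ⟨p.horizSq, p.t⟩)

theorem eq_one_of_koranyiNorm_eq_zero {p : HeisenbergGroup n} (h : p.koranyiNorm = 0) : p = 1 := by
  have h1 := koranyiNorm_sq p
  rw [h] at h1
  have h2 : (⟨p.horizSq, p.t⟩ : ℂ) = 0 := norm_eq_zero.1 (by rw [← h1]; norm_num)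
  have h3 : p.horizSq = 0 := congrArg Complex.re h2
  have h4 : p.t = 0 := congrArg Complex.im h2
  have h5 : ∀ j, p.x j ^ 2 + p.y j ^ 2 = 0 := fun j =>
    (Finset.sum_eq_zero_iff_of_nonneg (fun i _ => by positivity)).1 h3 j (Finset.mem_univ j)
  ext j
  · have := h5 j
    simp only [one_x, Pi.zero_apply]
    nlinarith [sq_nonneg (p.x j), sq_nonneg (p.y j)]
  · have := h5 j
    simp only [one_y, Pi.zero_apply]
    nlinarith [sq_nonneg (p.x j), sq_nonneg (p.y j)]
  · exact h4

theorem koranyiNorm_mul_le (p q : HeisenbergGroup n) :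
    (p * q).koranyiNorm ≤ p.koranyiNorm + q.koranyiNorm := by
  have hp := koranyiNorm_nonneg p
  have hq := koranyiNorm_nonneg q
  set c : ℂ := ∑ j, (⟨p.x j, p.y j⟩ : ℂ) * (⟨q.x j, -q.y j⟩ : ℂ) with hc
  have hre : c.re = ∑ j, (p.x j * q.x j + p.y j * q.y j) := by
    rw [hc, Complex.re_sum]
    exact Finset.sum_congr rfl fun j _ => by simp
  have him : c.im = ∑ j, (p.y j * q.x j - p.x j * q.y j) := by
    rw [hc, Complex.im_sum]
    exact Finset.sum_congr rfl fun j _ => by simp; ring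
  have hsplit : (⟨(p * q).horizSq, (p * q).t⟩ : ℂ)
      = ⟨p.horizSq, p.t⟩ + ⟨q.horizSq, q.t⟩ + 2 * c := by
    apply Complex.ext
    · simp only [Complex.add_re, Complex.mul_re, hre, horizSq, mul_x, mul_y, Pi.add_apply,
        Complex.re_ofNat, Complex.im_ofNat, zero_mul, sub_zero]
      rw [Finset.mul_sum, ← Finset.sum_add_distrib, ← Finset.sum_add_distrib]
      exact Finset.sum_congr rfl fun j _ => by ring
    · simp [him]
  have hcs : ‖c‖ ^ 2 ≤ p.horizSq * q.horizSq := by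
    have h1 : ‖c‖ ≤ ∑ j, ‖(⟨p.x j, p.y j⟩ : ℂ)‖ * ‖(⟨q.x j, -q.y j⟩ : ℂ)‖ :=
      (norm_sum_le _ _).trans (le_of_eq (Finset.sum_congr rfl fun j _ => norm_mul _ _))
    have h2 := Finset.sum_mul_sq_le_sq_mul_sq Finset.univ
      (fun j => ‖(⟨p.x j, p.y j⟩ : ℂ)‖) (fun j => ‖(⟨q.x j, -q.y j⟩ : ℂ)‖)
    have h3 : ‖c‖ ^ 2 ≤ (∑ j, ‖(⟨p.x j, p.y j⟩ : ℂ)‖ * ‖(⟨q.x j, -q.y j⟩ : ℂ)‖) ^ 2 :=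
      pow_le_pow_left₀ (norm_nonneg _) h1 2
    refine h3.trans (h2.trans (le_of_eq ?_))
    simp only [Complex.sq_norm, Complex.normSq_mk, horizSq]
    congr 1 <;> exact Finset.sum_congr rfl fun j _ => by ring
  have hcb : ‖c‖ ≤ p.koranyiNorm * q.koranyiNorm := by
    refine (sq_le_sq₀ (norm_nonneg _) (by positivity)).1 ?_
    rw [mul_pow]
    exact hcs.trans (mul_le_mul (horizSq_le p) (horizSq_le q) (horizSq_nonneg q) (by positivity))
  refine (sq_le_sq₀ (koranyiNorm_nonneg _) (by positivity)).1 ?_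
  rw [koranyiNorm_sq, hsplit]
  calc ‖(⟨p.horizSq, p.t⟩ + ⟨q.horizSq, q.t⟩ + 2 * c : ℂ)‖
      ≤ ‖(⟨p.horizSq, p.t⟩ : ℂ)‖ + ‖(⟨q.horizSq, q.t⟩ : ℂ)‖ + ‖2 * c‖ := norm_add₃_le
    _ = p.koranyiNorm ^ 2 + q.koranyiNorm ^ 2 + 2 * ‖c‖ := by
        rw [← koranyiNorm_sq, ← koranyiNorm_sq, norm_mul]; norm_num
    _ ≤ (p.koranyiNorm + q.koranyiNorm) ^ 2 := by nlinarith

/-- `ℍⁿ` as a metric space with the Korányi metric `d_K(p, q) = ‖q⁻¹ * p‖_K`. -/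
instance : MetricSpace (HeisenbergGroup n) where
  dist p q := (q⁻¹ * p).koranyiNorm
  dist_self p := by
    rw [inv_mul_cancel, koranyiNorm_one]
  dist_comm p q := by
    rw [← koranyiNorm_inv (q⁻¹ * p), mul_inv_rev, inv_inv]
  dist_triangle p q r := by
    have h := koranyiNorm_mul_le (r⁻¹ * q) (q⁻¹ * p)
    rw [show r⁻¹ * q * (q⁻¹ * p) = r⁻¹ * p by group] at h
    linarith
  eq_of_dist_eq_zero {p q} h := by
    have h1 : q⁻¹ * p = 1 := eq_one_of_koranyiNorm_eq_zero h
    exact (inv_mul_eq_one.1 h1).symm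

end HeisenbergGroup

/-- `f ∈ C^{0,α+}(s, Y)`: the quantity
`sup {d(f x, f y) / d(x, y)^α : x, y ∈ s, 0 < d(x, y) ≤ t}`, a supremum in `[0, ∞]`,
tends to `0` as `t → 0⁺`. -/
def HolderPlusOn {X Y : Type*} [MetricSpace X] [MetricSpace Y] (α : ℝ) (f : X → Y) (s : Set X) :
    Prop :=
  Tendsto
    (fun t : ℝ => ⨆ (x ∈ s) (y ∈ s) (_ : 0 < dist x y ∧ dist x y ≤ t),
      ENNReal.ofReal (dist (f x) (f y) / dist x y ^ α))
    (𝓝[>] 0) (𝓝 0)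

end

/-! An isometric copy of the (n+1)-ball inside the m-ball reduces the claim to m = n+1. Let f be
such a map, injective on the sphere. Extended radially and dilated by a large R, it oscillates at
unit scale by at most δ, a constant times ε R^(-(n+1)/(n+2)). After mollification at unit scale the
horizontal coordinates have gradients O(δ), and the pullback of the contact form τ = dt - 2 Σ (y_j
dx_j - x_j dy_j) is even O(δ²) (`HeisenbergOsc.almostHorizontal`).

One integral is then computed twice. By Stone–Weierstrass (`exists_contDiff_comp_near`) smooth
functions P_i of the coordinates of ℍⁿ nearly invert f on the sphere. Followed by a smooth step, P ∘
f behaves like a map of degree one, so its Jacobian has integral 1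
(`integral_jac_smoothStep_eq_one`).

On the other hand this Jacobian is the pullback of an (n+1)-form on ℍⁿ, which is expanded in the
coframe τ, dx_j, dy_j. Terms containing τ are O(δ² δⁿ). A purely horizontal term has degree above
half of 2n, so by hard Lefschetz (`exists_detRow_eq_sum_pairs`) it is divisible by ω = Σ dx_j ∧
dy_j. Since dτ = 4ω, integration by parts (`integral_sum_pairs_eq`) trades ω for τ and a derivative
of the coefficient, which gives δ · δ² · δ^(n-1). Integrated over a cube of volume O(R^(n+1)), both
kinds contribute O(δ^(n+2) R^(n+1)) (`exists_bound_integral_jac`). The exponent is chosen so that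
this is O(ε^(n+2)) uniformly in R, and a small ε contradicts the value 1. -/

open MeasureTheory
open scoped ContDiff Convolution

/-! ### Jacobian determinants as null Lagrangians -/

section Jacobian

variable {ι : Type*} [DecidableEq ι]

/-- The vector of partial derivatives of `u` at `x`. -/
noncomputable def grad (u : (ι → ℝ) → ℝ) (x : ι → ℝ) : ι → ℝ :=
  fun l => fderiv ℝ u x (Pi.single l 1)

theorem grad_eq_zero_of_notMem_tsupport {u : (ι → ℝ) → ℝ} {x : ι → ℝ} (hx : x ∉ tsupport u) :
    grad u x = 0 := by
  have h : u =ᶠ[𝓝 x] fun _ => 0 := notMem_tsupport_iff_eventuallyEq.1 hx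
  ext l
  simp [grad, h.fderiv_eq]

variable [Fintype ι]

/-- The Jacobian determinant of the functions `u i`, whose rows are the gradients. -/
noncomputable def jac (u : ι → (ι → ℝ) → ℝ) (x : ι → ℝ) : ℝ :=
  Matrix.detRowAlternating fun i => grad (u i) x

theorem detRow_apply (r : ι → ι → ℝ) :
    Matrix.detRowAlternating r
      = ∑ σ : Equiv.Perm ι, ((Equiv.Perm.sign σ : ℤ) : ℝ) * ∏ i, r i (σ i) := by
  have h : Matrix.detRowAlternating r = (Matrix.of r).transpose.det :=
    (Matrix.det_transpose (Matrix.of r)).symm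
  rw [h, Matrix.det_apply']
  rfl

theorem contDiff_grad {u : (ι → ℝ) → ℝ} (hu : ContDiff ℝ ∞ u) (l : ι) :
    ContDiff ℝ ∞ fun x => grad u x l :=
  (hu.fderiv_right (m := ∞) (by simp)).clm_apply contDiff_const

theorem grad_comm {u : (ι → ℝ) → ℝ} (hu : ContDiff ℝ ∞ u) (l k : ι) (x : ι → ℝ) :
    grad (fun y => grad u y l) x k = grad (fun y => grad u y k) x l := by
  have hd : DifferentiableAt ℝ (fderiv ℝ u) x :=
    ((hu.fderiv_right (m := ∞) (by simp)).differentiable (by simp)) x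
  have h : ∀ a b : ι, grad (fun y => grad u y a) x b
      = fderiv ℝ (fderiv ℝ u) x (Pi.single b 1) (Pi.single a 1) := by
    intro a b
    unfold grad
    rw [fderiv_clm_apply hd (differentiableAt_const _)]
    simp
  rw [h, h]
  exact (hu.contDiffAt.isSymmSndFDerivAt (by
    rw [minSmoothness_of_isRCLikeNormedField]; exact WithTop.coe_le_coe.2 (le_top : (2 : ℕ∞) ≤ ⊤))) _ _

theorem continuous_grad {u : (ι → ℝ) → ℝ} (hu : ContDiff ℝ ∞ u) : Continuous (grad u) :=
  continuous_pi fun l => (contDiff_grad hu l).continuous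

theorem continuous_detRow {Y : Type*} [TopologicalSpace Y] {r : Y → ι → ι → ℝ}
    (hr : Continuous r) : Continuous fun y => Matrix.detRowAlternating (r y) := by
  simp only [detRow_apply]
  fun_prop

theorem continuous_jac {u : ι → (ι → ℝ) → ℝ} (hu : ∀ i, ContDiff ℝ ∞ (u i)) :
    Continuous (jac u) :=
  continuous_detRow (continuous_pi fun i => continuous_grad (hu i))

theorem hasCompactSupport_jac {u : ι → (ι → ℝ) → ℝ} (i₀ : ι) (hc : HasCompactSupport (u i₀)) :
    HasCompactSupport (jac u) := by
  refine HasCompactSupport.intro' hc (isClosed_tsupport _) fun x hx => ?_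
  exact AlternatingMap.map_coord_zero _ i₀ (grad_eq_zero_of_notMem_tsupport hx)

/-- The cofactors of row `i₀` form a divergence-free field (Piola identity). Each term of the
Leibniz expansion contains one second derivative of some `u k`; composing `σ` with the transposition
of `i₀` and `k` swaps the two differentiation directions, which changes nothing, and flips the sign.
-/
theorem sum_sign_mul_grad_prod_eq_zero {u : ι → (ι → ℝ) → ℝ} (hu : ∀ i, ContDiff ℝ ∞ (u i))
    (i₀ : ι) (x : ι → ℝ) :
    ∑ σ : Equiv.Perm ι, ((Equiv.Perm.sign σ : ℤ) : ℝ) *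
      grad (fun y => ∏ i ∈ Finset.univ.erase i₀, grad (u i) y (σ i)) x (σ i₀) = 0 := by
  have h1 : ∀ σ : Equiv.Perm ι,
      grad (fun y => ∏ i ∈ Finset.univ.erase i₀, grad (u i) y (σ i)) x (σ i₀)
        = ∑ k ∈ Finset.univ.erase i₀, (∏ j ∈ (Finset.univ.erase i₀).erase k, grad (u j) x (σ j))
          * grad (fun y => grad (u k) y (σ k)) x (σ i₀) := by
    intro σ
    rw [grad, fderiv_finsetProd fun i _ => ((contDiff_grad (hu i) _).differentiable (by simp)) x]
    simp [grad]
  simp only [h1, Finset.mul_sum]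
  rw [Finset.sum_comm]
  refine Finset.sum_eq_zero fun k hk => ?_
  have hk0 : k ≠ i₀ := Finset.ne_of_mem_erase hk
  refine Finset.sum_involution (fun σ _ => σ * Equiv.swap i₀ k) ?_ ?_ (fun _ _ => Finset.mem_univ _)
    ?_
  · intro σ _
    have e1 : ∏ j ∈ (Finset.univ.erase i₀).erase k, grad (u j) x ((σ * Equiv.swap i₀ k) j)
        = ∏ j ∈ (Finset.univ.erase i₀).erase k, grad (u j) x (σ j) := by
      refine Finset.prod_congr rfl fun j hj => ?_
      have hj1 : j ≠ k := Finset.ne_of_mem_erase hj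
      have hj2 : j ≠ i₀ := Finset.ne_of_mem_erase (Finset.mem_of_mem_erase hj)
      rw [Equiv.Perm.mul_apply, Equiv.swap_apply_of_ne_of_ne hj2 hj1]
    rw [e1, Equiv.Perm.sign_mul, Equiv.Perm.sign_swap hk0.symm]
    simp only [Equiv.Perm.mul_apply, Equiv.swap_apply_left, Equiv.swap_apply_right]
    rw [grad_comm (hu k) (σ i₀) (σ k)]
    push_cast
    ring
  · intro σ _ _ h
    have h2 : Equiv.swap i₀ k = 1 := by simpa using h
    exact hk0.symm (Equiv.swap_eq_one_iff.1 h2)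
  · intro σ _
    simp [mul_assoc]

/-- The integral of a Jacobian determinant vanishes when one of the functions is compactly
supported. -/
theorem integral_jac_eq_zero {u : ι → (ι → ℝ) → ℝ} (hu : ∀ i, ContDiff ℝ ∞ (u i)) (i₀ : ι)
    (hc : HasCompactSupport (u i₀)) : ∫ x, jac u x = 0 := by
  set w : Equiv.Perm ι → (ι → ℝ) → ℝ :=
    fun σ y => ∏ i ∈ Finset.univ.erase i₀, grad (u i) y (σ i) with hw
  have hwd : ∀ σ, ContDiff ℝ ∞ (w σ) := fun σ =>
    contDiff_prod fun i _ => contDiff_grad (hu i) _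
  have h1 : ∀ x, jac u x = ∑ σ : Equiv.Perm ι, ((Equiv.Perm.sign σ : ℤ) : ℝ) *
      (grad (u i₀) x (σ i₀) * w σ x) := by
    intro x
    rw [jac, detRow_apply]
    refine Finset.sum_congr rfl fun σ _ => ?_
    rw [hw, Finset.mul_prod_erase _ (fun i => grad (u i) x (σ i)) (Finset.mem_univ i₀)]
  have hcg : ∀ l, HasCompactSupport fun x => grad (u i₀) x l := fun l =>
    HasCompactSupport.intro' hc (isClosed_tsupport _) fun x hx => by
      rw [grad_eq_zero_of_notMem_tsupport hx, Pi.zero_apply]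
  have i1 : ∀ σ : Equiv.Perm ι, Integrable fun x => grad (u i₀) x (σ i₀) * w σ x := fun σ =>
    ((contDiff_grad (hu i₀) _).continuous.mul (hwd σ).continuous).integrable_of_hasCompactSupport
      (hcg _).mul_right
  have i2 : ∀ σ : Equiv.Perm ι, Integrable fun x => u i₀ x * grad (w σ) x (σ i₀) := fun σ =>
    ((hu i₀).continuous.mul (contDiff_grad (hwd σ) _).continuous).integrable_of_hasCompactSupport
      hc.mul_right
  have i3 : ∀ σ : Equiv.Perm ι, Integrable fun x => u i₀ x * w σ x := fun σ =>
    ((hu i₀).continuous.mul (hwd σ).continuous).integrable_of_hasCompactSupport hc.mul_right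
  have h2 : ∀ σ : Equiv.Perm ι, ∫ x, grad (u i₀) x (σ i₀) * w σ x
      = -∫ x, u i₀ x * grad (w σ) x (σ i₀) := by
    intro σ
    have := integral_mul_fderiv_eq_neg_fderiv_mul_of_integrable (i1 σ) (i2 σ) (i3 σ)
      (fun x _ => (hu i₀).differentiable (by simp) x) (fun x _ => (hwd σ).differentiable (by simp) x)
    change ∫ x, u i₀ x * grad (w σ) x (σ i₀) = -∫ x, grad (u i₀) x (σ i₀) * w σ x at this
    linarith
  simp only [h1]
  rw [integral_finsetSum _ fun σ _ => (i1 σ).const_mul _]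
  simp only [integral_const_mul, h2, mul_neg, Finset.sum_neg_distrib, neg_eq_zero]
  simp only [← integral_const_mul]
  rw [← integral_finsetSum _ fun σ _ => (i2 σ).const_mul _]
  refine integral_eq_zero_of_ae (Eventually.of_forall fun x => ?_)
  have := sum_sign_mul_grad_prod_eq_zero hu i₀ x
  calc _ = u i₀ x * ∑ σ : Equiv.Perm ι, ((Equiv.Perm.sign σ : ℤ) : ℝ) * grad (w σ) x (σ i₀) := by
        rw [Finset.mul_sum]
        exact Finset.sum_congr rfl fun σ _ => by ring
    _ = 0 := by rw [this, mul_zero]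

theorem grad_sub {u v : (ι → ℝ) → ℝ} (hu : ContDiff ℝ ∞ u) (hv : ContDiff ℝ ∞ v) (x : ι → ℝ) :
    grad (fun y => u y - v y) x = grad u x - grad v x := by
  ext l
  simp [grad, fderiv_fun_sub (hu.differentiable (by simp) x) (hv.differentiable (by simp) x)]

theorem grad_mul {u v : (ι → ℝ) → ℝ} (hu : ContDiff ℝ ∞ u) (hv : ContDiff ℝ ∞ v) (x : ι → ℝ) :
    grad (fun y => u y * v y) x = u x • grad v x + v x • grad u x := by
  ext l
  simp [grad, fderiv_fun_mul (hu.differentiable (by simp) x) (hv.differentiable (by simp) x)]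

/-- The integral of the Jacobian determinant does not change under compactly supported
perturbations. -/
theorem integral_jac_eq_of_hasCompactSupport_sub {u v : ι → (ι → ℝ) → ℝ}
    (hu : ∀ i, ContDiff ℝ ∞ (u i)) (hv : ∀ i, ContDiff ℝ ∞ (v i))
    (hc : ∀ i, HasCompactSupport fun x => u i x - v i x) (hint : Integrable (jac v)) :
    ∫ x, jac u x = ∫ x, jac v x := by
  classical
  -- Each row is split as `v i + (u i - v i)`; `s` records the rows taken from `v`. Every choice
  -- except `s = univ` keeps a compactly supported row, so its Jacobian integrates to zero.
  set m : Finset ι → ι → (ι → ℝ) → ℝ :=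
    fun s => s.piecewise v (fun i x => u i x - v i x) with hm
  have hmd : ∀ s i, ContDiff ℝ ∞ (m s i) := by
    intro s i
    by_cases h : i ∈ s
    · simp only [hm, Finset.piecewise_eq_of_mem _ _ _ h]; exact hv i
    · simp only [hm, Finset.piecewise_eq_of_notMem _ _ _ h]; exact (hu i).sub (hv i)
  have hmc : ∀ s : Finset ι, s ≠ Finset.univ → ∃ i, HasCompactSupport (m s i) := by
    intro s hs
    obtain ⟨i, hi⟩ : ∃ i, i ∉ s := by
      by_contra! h
      exact hs (Finset.eq_univ_iff_forall.2 h)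
    exact ⟨i, by simp only [hm, Finset.piecewise_eq_of_notMem _ _ _ hi]; exact hc i⟩
  have hexp : ∀ x, jac u x = jac v x + ∑ s ∈ Finset.univ.erase Finset.univ, jac (m s) x := by
    intro x
    have h1 : (fun i => grad (u i) x)
        = (fun i => grad (v i) x) + fun i => grad (fun y => u i y - v i y) x := by
      ext i l
      simp [grad_sub (hu i) (hv i)]
    have h2 : ∀ s : Finset ι, jac (m s) x = Matrix.detRowAlternating
        (s.piecewise (fun i => grad (v i) x) fun i => grad (fun y => u i y - v i y) x) := by
      intro s
      rw [jac]
      congr 1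
      ext i l
      by_cases h : i ∈ s <;> simp [hm, h]
    have h3 := MultilinearMap.map_add_univ
      (Matrix.detRowAlternating (n := ι) (R := ℝ)).toMultilinearMap
      (fun i => grad (v i) x) (fun i => grad (fun y => u i y - v i y) x)
    have h4 : jac v x = jac (m Finset.univ) x := by simp [hm]
    rw [h4, Finset.add_sum_erase _ (fun s => jac (m s) x) (Finset.mem_univ _), jac, h1]
    simp only [h2]
    exact h3
  have hi : ∀ s ∈ Finset.univ.erase (Finset.univ : Finset ι), Integrable (jac (m s)) := by
    intro s hs
    obtain ⟨i, hi⟩ := hmc s (Finset.ne_of_mem_erase hs)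
    exact (continuous_jac (hmd s)).integrable_of_hasCompactSupport (hasCompactSupport_jac i hi)
  simp only [hexp]
  rw [integral_add hint (integrable_finsetSum _ hi), integral_finsetSum _ hi,
    Finset.sum_eq_zero, add_zero]
  intro s hs
  obtain ⟨i, hi⟩ := hmc s (Finset.ne_of_mem_erase hs)
  exact integral_jac_eq_zero (hmd s) i hi

end Jacobian

open scoped Pointwise

/-! ### Hard Lefschetz in an exterior algebra -/

section Lefschetz

variable {A : Type*} [Ring A]

/-- The relations of an exterior algebra for two families of generators. -/
structure ExteriorRelations (a b : ℕ → A) : Prop where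
  aa : ∀ i j, a i * a j = -(a j * a i)
  bb : ∀ i j, b i * b j = -(b j * b i)
  ab : ∀ i j, a i * b j = -(b j * a i)
  a_sq : ∀ i, a i * a i = 0
  b_sq : ∀ i, b i * b i = 0

variable {a b : ℕ → A}

/-- A product of two odd elements passes an odd generator at the cost of two cancelling signs. Hence
the symplectic element is central among the generators. -/
theorem ExteriorRelations.commute_a (h : ExteriorRelations a b) (i j : ℕ) :
    Commute (a i * b i) (a j) := by
  unfold Commute SemiconjBy
  rw [mul_assoc, ← neg_neg (b i * a j), ← h.ab, mul_neg, ← mul_assoc, h.aa i j, neg_mul, neg_neg,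
    mul_assoc]

theorem ExteriorRelations.commute_b (h : ExteriorRelations a b) (i j : ℕ) :
    Commute (a i * b i) (b j) := by
  unfold Commute SemiconjBy
  rw [mul_assoc, h.bb i j, mul_neg, ← mul_assoc, h.ab i j, neg_mul, neg_neg, mul_assoc]

theorem ExteriorRelations.pair_sq (h : ExteriorRelations a b) (i : ℕ) :
    a i * b i * (a i * b i) = 0 := by
  rw [← mul_assoc, (h.commute_a i i).eq, ← mul_assoc, h.a_sq]
  simp

/-- The sum of the first `m` products `a j * b j`. -/
def pairSum (a b : ℕ → A) (m : ℕ) : A := ∑ j ∈ Finset.range m, a j * b j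

theorem ExteriorRelations.pairSum_commute_a (h : ExteriorRelations a b) (m j : ℕ) :
    Commute (pairSum a b m) (a j) :=
  Commute.sum_left _ _ _ fun i _ => h.commute_a i j

theorem ExteriorRelations.pairSum_commute_b (h : ExteriorRelations a b) (m j : ℕ) :
    Commute (pairSum a b m) (b j) :=
  Commute.sum_left _ _ _ fun i _ => h.commute_b i j

variable [Algebra ℝ A]

/-- The span of the monomials of degree `d` in the first `m` pairs of generators `a j`, `b j`. -/
noncomputable def pairSpan (a b : ℕ → A) : ℕ → ℤ → Submodule ℝ A
  -- Degrees are integers: truncated subtraction would put `a m` and `b m` themselves into degree 0.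
  | 0, d => if d = 0 then Submodule.span ℝ {1} else ⊥
  | m + 1, d => pairSpan a b m d ⊔ (pairSpan a b m (d - 1)).map (LinearMap.mulLeft ℝ (a m)) ⊔
      (pairSpan a b m (d - 1)).map (LinearMap.mulLeft ℝ (b m)) ⊔
      (pairSpan a b m (d - 2)).map (LinearMap.mulLeft ℝ (a m * b m))

theorem mem_pairSpan_succ {m : ℕ} {d : ℤ} {w : A} :
    w ∈ pairSpan a b (m + 1) d ↔ ∃ w₀ ∈ pairSpan a b m d, ∃ w₁ ∈ pairSpan a b m (d - 1),
      ∃ w₂ ∈ pairSpan a b m (d - 1), ∃ w₃ ∈ pairSpan a b m (d - 2),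
        w = w₀ + a m * w₁ + b m * w₂ + a m * b m * w₃ := by
  simp only [pairSpan, Submodule.mem_sup, Submodule.mem_map, LinearMap.mulLeft_apply]
  constructor
  · rintro ⟨_, ⟨_, ⟨w₀, h0, _, ⟨w₁, h1, rfl⟩, rfl⟩, _, ⟨w₂, h2, rfl⟩, rfl⟩, _, ⟨w₃, h3, rfl⟩, rfl⟩
    exact ⟨w₀, h0, w₁, h1, w₂, h2, w₃, h3, rfl⟩
  · rintro ⟨w₀, h0, w₁, h1, w₂, h2, w₃, h3, rfl⟩
    exact ⟨_, ⟨_, ⟨w₀, h0, _, ⟨w₁, h1, rfl⟩, rfl⟩, _, ⟨w₂, h2, rfl⟩, rfl⟩, _, ⟨w₃, h3, rfl⟩, rfl⟩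

/-- The binomial formula stops after the linear term in `p`. The coefficient `k + 1` is what must be
inverted in the Lefschetz induction, hence the real scalars. -/
theorem add_pow_succ_of_commute_of_sq_eq_zero {x p : A} (hc : Commute x p) (hp : p * p = 0)
    (k : ℕ) : (x + p) ^ (k + 1) = x ^ (k + 1) + (k + 1 : ℝ) • (x ^ k * p) := by
  induction k with
  | zero => simp
  | succ k ih =>
    rw [pow_succ, ih, add_mul, mul_add, mul_add, smul_mul_assoc, smul_mul_assoc, mul_assoc _ p p, hp,
      mul_assoc _ p x, ← hc.eq, ← mul_assoc, ← pow_succ, ← pow_succ]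
    rw [mul_zero, smul_zero, add_zero, add_assoc]
    push_cast
    congr 1
    module

theorem ExteriorRelations.a_mul_mem (h : ExteriorRelations a b) {i m : ℕ} (hi : i < m) (d : ℤ)
    {w : A} (hw : w ∈ pairSpan a b m d) : a i * w ∈ pairSpan a b m (d + 1) := by
  induction m generalizing d w with
  | zero => omega
  | succ m ih =>
    obtain ⟨w₀, h0, w₁, h1, w₂, h2, w₃, h3, rfl⟩ := mem_pairSpan_succ.1 hw
    rw [mem_pairSpan_succ]
    rcases Nat.lt_succ_iff_lt_or_eq.1 hi with hlt | rfl
    · refine ⟨a i * w₀, ih hlt _ h0, -(a i * w₁), ?_, -(a i * w₂), ?_, a i * w₃, ?_, ?_⟩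
      · rw [show d + 1 - 1 = d - 1 + 1 by ring]
        exact Submodule.neg_mem _ (ih hlt _ h1)
      · rw [show d + 1 - 1 = d - 1 + 1 by ring]
        exact Submodule.neg_mem _ (ih hlt _ h2)
      · rw [show d + 1 - 2 = d - 2 + 1 by ring]
        exact ih hlt _ h3
      · rw [mul_add, mul_add, mul_add, ← mul_assoc (a i) (a m) w₁, h.aa i m,
          ← mul_assoc (a i) (b m) w₂, h.ab i m, ← mul_assoc (a i) (a m * b m) w₃,
          ← (h.commute_a m i).eq]
        noncomm_ring
    -- Multiplication by `a i` kills the components that already contain it; `w₀` and `w₂` move to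
    -- the slots with one more factor `a i`.
    · refine ⟨0, Submodule.zero_mem _, w₀, by simpa using h0, 0, Submodule.zero_mem _, w₂, ?_, ?_⟩
      · rw [show d + 1 - 2 = d - 1 by ring]; exact h2
      · rw [mul_add, mul_add, mul_add, ← mul_assoc (a i) (a i) w₁, h.a_sq,
          ← mul_assoc (a i) (a i * b i) w₃, ← mul_assoc (a i) (a i), h.a_sq]
        noncomm_ring

theorem ExteriorRelations.b_mul_mem (h : ExteriorRelations a b) {i m : ℕ} (hi : i < m) (d : ℤ)
    {w : A} (hw : w ∈ pairSpan a b m d) : b i * w ∈ pairSpan a b m (d + 1) := by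
  induction m generalizing d w with
  | zero => omega
  | succ m ih =>
    obtain ⟨w₀, h0, w₁, h1, w₂, h2, w₃, h3, rfl⟩ := mem_pairSpan_succ.1 hw
    have hba : ∀ j, b i * a j = -(a j * b i) := fun j => by rw [h.ab, neg_neg]
    rw [mem_pairSpan_succ]
    rcases Nat.lt_succ_iff_lt_or_eq.1 hi with hlt | rfl
    · refine ⟨b i * w₀, ih hlt _ h0, -(b i * w₁), ?_, -(b i * w₂), ?_, b i * w₃, ?_, ?_⟩
      · rw [show d + 1 - 1 = d - 1 + 1 by ring]
        exact Submodule.neg_mem _ (ih hlt _ h1)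
      · rw [show d + 1 - 1 = d - 1 + 1 by ring]
        exact Submodule.neg_mem _ (ih hlt _ h2)
      · rw [show d + 1 - 2 = d - 2 + 1 by ring]
        exact ih hlt _ h3
      · rw [mul_add, mul_add, mul_add, ← mul_assoc (b i) (a m) w₁, hba m,
          ← mul_assoc (b i) (b m) w₂, h.bb i m, ← mul_assoc (b i) (a m * b m) w₃,
          ← (h.commute_b m i).eq]
        noncomm_ring
    · refine ⟨0, Submodule.zero_mem _, 0, Submodule.zero_mem _, w₀, by simpa using h0, -w₁, ?_, ?_⟩
      · rw [show d + 1 - 2 = d - 1 by ring]; exact Submodule.neg_mem _ h1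
      · rw [mul_add, mul_add, mul_add, ← mul_assoc (b i) (a i) w₁, hba i,
          ← mul_assoc (b i) (b i) w₂, h.b_sq, ← mul_assoc (b i) (a i * b i) w₃,
          ← (h.commute_b i i).eq, mul_assoc (a i) (b i) (b i), h.b_sq]
        noncomm_ring

theorem ExteriorRelations.pairSum_mul_mem (h : ExteriorRelations a b) {m : ℕ} (d : ℤ)
    {w : A} (hw : w ∈ pairSpan a b m d) : pairSum a b m * w ∈ pairSpan a b m (d + 2) := by
  rw [pairSum, Finset.sum_mul]
  refine Submodule.sum_mem _ fun j hj => ?_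
  have hj' := Finset.mem_range.1 hj
  rw [mul_assoc, show d + 2 = d + 1 + 1 by ring]
  exact h.a_mul_mem hj' _ (h.b_mul_mem hj' _ hw)

theorem ExteriorRelations.pairSum_pow_mul_mem (h : ExteriorRelations a b) {m : ℕ} (d : ℤ)
    {w : A} (hw : w ∈ pairSpan a b m d) (k : ℕ) :
    pairSum a b m ^ k * w ∈ pairSpan a b m (d + 2 * k) := by
  induction k with
  | zero => simpa using hw
  | succ k ih =>
    rw [pow_succ', mul_assoc, show d + 2 * ((k + 1 : ℕ) : ℤ) = d + 2 * k + 2 by push_cast; ring]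
    exact h.pairSum_mul_mem _ ih

/-- Hard Lefschetz: in degree `m + k` every element is a multiple of the `k`-th power of the
symplectic element. -/
theorem ExteriorRelations.exists_eq_pairSum_pow_mul (h : ExteriorRelations a b) (m : ℕ) :
    ∀ (k : ℕ) (w : A), w ∈ pairSpan a b m (m + k) →
      ∃ u ∈ pairSpan a b m (m - k), w = pairSum a b m ^ k * u := by
  induction m with
  | zero =>
    intro k w hw
    rcases Nat.eq_zero_or_pos k with rfl | hk
    · exact ⟨w, by simpa using hw, by simp⟩
    · have h0 : w = 0 := by
        have hk' : ¬ ((0 : ℕ) : ℤ) + (k : ℤ) = 0 := by omega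
        rw [pairSpan, if_neg hk'] at hw
        simpa using hw
      exact ⟨0, Submodule.zero_mem _, by simp [h0]⟩
  | succ m ih =>
    intro k w hw
    rcases k with _ | k
    · exact ⟨w, by simpa using hw, by simp⟩
    -- The last pair is split off. Relative to the middle degree `m` of the remaining pairs, `w₀`
    -- has surplus `k + 2`, `w₁` and `w₂` have `k + 1`, and `w₃` has `k`, so the induction
    -- hypothesis applies to each with a different power.
    obtain ⟨w₀, h0, w₁, h1, w₂, h2, w₃, h3, rfl⟩ := mem_pairSpan_succ.1 hw
    set p := a m * b m with hp
    set x := pairSum a b m with hx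
    have hs : pairSum a b (m + 1) = x + p := Finset.sum_range_succ _ _
    have hc : Commute x p := (h.pairSum_commute_a m m).mul_right (h.pairSum_commute_b m m)
    have hpp : p * p = 0 := h.pair_sq m
    have hpow := fun k => add_pow_succ_of_commute_of_sq_eq_zero hc hpp k
    rw [hs]
    have hdeg : ((m + 1 : ℕ) : ℤ) - ((k + 1 : ℕ) : ℤ) = m - k := by push_cast; ring
    rw [hdeg]
    have key0 : ∀ v ∈ pairSpan a b m (m + (k + 2 : ℕ)),
        ∃ u ∈ pairSpan a b (m + 1) (m - k), v = (x + p) ^ (k + 1) * u := by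
      intro v hv
      obtain ⟨u, hu, rfl⟩ := ih (k + 2) v hv
      -- In `(x + p) ^ (k + 1)` times this witness the cross terms `±(k + 1) x ^ (k + 1) p u` cancel
      -- and `p * p = 0` removes the rest, leaving `x ^ (k + 2) * u`.
      refine ⟨x * u + p * (-(k + 1 : ℝ) • u), ?_, ?_⟩
      · refine mem_pairSpan_succ.2 ⟨x * u, ?_, 0, Submodule.zero_mem _, 0, Submodule.zero_mem _,
          -(k + 1 : ℝ) • u, Submodule.smul_mem _ _ ?_, by simp [hp]⟩
        · rw [show (m : ℤ) - k = m - (k + 2 : ℕ) + 2 by push_cast; ring]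
          exact h.pairSum_mul_mem _ hu
        · rwa [show (m : ℤ) - k - 2 = m - (k + 2 : ℕ) by push_cast; ring]
      · have e1 : x ^ k * p * (x * u) = x ^ (k + 1) * (p * u) := by
          rw [mul_assoc, ← mul_assoc p x u, ← hc.eq, pow_succ]
          simp only [mul_assoc]
        have e2 : x ^ k * p * (p * u) = 0 := by
          rw [mul_assoc, ← mul_assoc p p u, hpp]; simp
        have e3 : x ^ (k + 1) * (x * u) = x ^ (k + 2) * u := by
          rw [← mul_assoc, ← pow_succ]
        rw [hpow, add_mul, mul_add, mul_add, mul_smul_comm, mul_smul_comm, mul_smul_comm,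
          smul_mul_assoc, smul_mul_assoc, e1, e2, e3]
        module
    -- The generators `a m` and `b m` annihilate `p`, so on their multiples `x + p` acts as `x`.
    have key1 : ∀ c : A, Commute x c → p * c = 0 → ∀ v ∈ pairSpan a b m (m + (k + 1 : ℕ)),
        ∃ u ∈ pairSpan a b m (m - k - 1), c * v = (x + p) ^ (k + 1) * (c * u) := by
      intro c hxc hpc v hv
      obtain ⟨u, hu, rfl⟩ := ih (k + 1) v hv
      refine ⟨u, ?_, ?_⟩
      · rwa [show (m : ℤ) - k - 1 = m - (k + 1 : ℕ) by push_cast; ring]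
      · rw [hpow, add_mul, smul_mul_assoc, mul_assoc _ p, ← mul_assoc p c, hpc, zero_mul, mul_zero,
          smul_zero, add_zero, ← mul_assoc, ← mul_assoc, (hxc.pow_left (k + 1)).eq]
    obtain ⟨u₀, hu0, e0⟩ := key0 w₀ (by
      rwa [show (m : ℤ) + (k + 2 : ℕ) = (m + 1 : ℕ) + (k + 1 : ℕ) by push_cast; ring])
    have hd1 : (m : ℤ) + (k + 1 : ℕ) = (m + 1 : ℕ) + (k + 1 : ℕ) - 1 := by push_cast; ring
    obtain ⟨u₁, hu1, e1⟩ := key1 (a m) (h.pairSum_commute_a m m)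
      (by rw [hp, (h.commute_a m m).eq, ← mul_assoc, h.a_sq, zero_mul]) w₁ (by rwa [hd1])
    obtain ⟨u₂, hu2, e2⟩ := key1 (b m) (h.pairSum_commute_b m m)
      (by rw [hp, mul_assoc, h.b_sq, mul_zero]) w₂ (by rwa [hd1])
    obtain ⟨u₃, hu3, e3⟩ := ih k w₃ (by
      rwa [show (m : ℤ) + k = (m + 1 : ℕ) + (k + 1 : ℕ) - 2 by push_cast; ring])
    -- Applying `(x + p) ^ (k + 1)` to `u₃` gives `(k + 1) p w₃` plus the unwanted `x ^ (k + 1) u₃`.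
    -- The latter has surplus `k + 2`, so it is itself in the image, by `key0`, and can be
    -- subtracted.
    obtain ⟨u₄, hu4, e4⟩ := key0 (x ^ (k + 1) * u₃) (by
      rw [show (m : ℤ) + (k + 2 : ℕ) = m - k + 2 * (k + 1 : ℕ) by push_cast; ring]
      exact h.pairSum_pow_mul_mem _ hu3 _)
    have hu3' : u₃ ∈ pairSpan a b (m + 1) (m - k) :=
      mem_pairSpan_succ.2 ⟨u₃, hu3, 0, Submodule.zero_mem _, 0, Submodule.zero_mem _, 0,
        Submodule.zero_mem _, by simp⟩
    have hk : (k + 1 : ℝ) ≠ 0 := by positivity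
    have e5 : p * w₃ = (x + p) ^ (k + 1) * ((k + 1 : ℝ)⁻¹ • (u₃ - u₄)) := by
      rw [mul_smul_comm, mul_sub, ← e4, hpow, add_mul, add_sub_cancel_left, smul_mul_assoc,
        smul_smul, inv_mul_cancel₀ hk, one_smul, e3, ← mul_assoc, (hc.pow_left k).eq]
    refine ⟨u₀ + a m * u₁ + b m * u₂ + (k + 1 : ℝ)⁻¹ • (u₃ - u₄), ?_, ?_⟩
    · refine Submodule.add_mem _ (Submodule.add_mem _ (Submodule.add_mem _ hu0 ?_) ?_)
        (Submodule.smul_mem _ _ (Submodule.sub_mem _ hu3' hu4))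
      · exact mem_pairSpan_succ.2 ⟨0, Submodule.zero_mem _, u₁, hu1, 0, Submodule.zero_mem _, 0,
          Submodule.zero_mem _, by simp⟩
      · exact mem_pairSpan_succ.2 ⟨0, Submodule.zero_mem _, 0, Submodule.zero_mem _, u₂, hu2, 0,
          Submodule.zero_mem _, by simp⟩
    · rw [mul_add, mul_add, mul_add, ← e0, ← e1, ← e2, ← e5]

theorem one_mem_pairSpan (m : ℕ) : (1 : A) ∈ pairSpan a b m 0 := by
  induction m with
  | zero => simp [pairSpan, Submodule.mem_span_singleton_self]
  | succ m ih =>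
    exact mem_pairSpan_succ.2 ⟨1, ih, 0, Submodule.zero_mem _, 0, Submodule.zero_mem _, 0,
      Submodule.zero_mem _, by simp⟩

/-- The vanishing in negative degrees is part of the induction, because the recursion lowers the
degree by one or two and may leave the natural numbers. -/
theorem mem_pow_of_mem_pairSpan {S : Submodule ℝ A} (ha : ∀ i, a i ∈ S) (hb : ∀ i, b i ∈ S)
    (m : ℕ) : ∀ (d : ℤ) (w : A), w ∈ pairSpan a b m d →
      (∀ e : ℕ, d = e → w ∈ S ^ e) ∧ (d < 0 → w = 0) := by
  induction m with
  | zero =>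
    intro d w hw
    by_cases hd : d = 0
    · rw [pairSpan, if_pos hd] at hw
      refine ⟨fun e he => ?_, fun h => by omega⟩
      obtain rfl : e = 0 := by omega
      rw [pow_zero, Submodule.one_eq_span]
      exact hw
    · rw [pairSpan, if_neg hd, Submodule.mem_bot] at hw
      subst hw
      exact ⟨fun _ _ => Submodule.zero_mem _, fun _ => rfl⟩
  | succ m ih =>
    intro d w hw
    obtain ⟨w₀, h0, w₁, h1, w₂, h2, w₃, h3, rfl⟩ := mem_pairSpan_succ.1 hw
    have i0 := ih _ _ h0
    have i1 := ih _ _ h1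
    have i2 := ih _ _ h2
    have i3 := ih _ _ h3
    have step : ∀ c ∈ S, ∀ v : A, ((∀ e : ℕ, d - 1 = e → v ∈ S ^ e) ∧ (d - 1 < 0 → v = 0)) →
        ∀ e : ℕ, d = e → c * v ∈ S ^ e := by
      intro c hc v hv e he
      rcases e with _ | e
      · rw [hv.2 (by omega), mul_zero]; exact Submodule.zero_mem _
      · rw [pow_succ']
        exact Submodule.mul_mem_mul hc (hv.1 e (by omega))
    have step2 : (∀ e : ℕ, d - 1 = e → b m * w₃ ∈ S ^ e) ∧ (d - 1 < 0 → b m * w₃ = 0) := by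
      refine ⟨fun e he => ?_, fun h => by rw [i3.2 (by omega), mul_zero]⟩
      rcases e with _ | e
      · rw [i3.2 (by omega), mul_zero]; exact Submodule.zero_mem _
      · rw [pow_succ']
        exact Submodule.mul_mem_mul (hb m) (i3.1 e (by omega))
    refine ⟨fun e he => ?_, fun h => ?_⟩
    · rw [mul_assoc]
      exact Submodule.add_mem _ (Submodule.add_mem _ (Submodule.add_mem _ (i0.1 e he)
        (step _ (ha m) _ i1 e he)) (step _ (hb m) _ i2 e he)) (step _ (ha m) _ step2 e he)
    · rw [i0.2 h, i1.2 (by omega), i2.2 (by omega), i3.2 (by omega)]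
      simp

end Lefschetz

/-- Lefschetz decomposition for determinants: a determinant of `n + 2` vectors out of `n + 1` pairs
is a linear combination of traces over the pairs. -/
theorem exists_detRow_eq_sum_pairs {n : ℕ} (κ : Fin (n + 2) → Fin (n + 1) ⊕ Fin (n + 1)) :
    ∃ w : (Fin n → Fin (n + 1) ⊕ Fin (n + 1)) → ℝ,
      ∀ ζ : Fin (n + 1) ⊕ Fin (n + 1) → Fin (n + 2) → ℝ,
        Matrix.detRowAlternating (fun i => ζ (κ i)) = ∑ l, w l * ∑ j,
          Matrix.detRowAlternating
            (Matrix.vecCons (ζ (.inl j)) (Matrix.vecCons (ζ (.inr j)) fun i => ζ (l i))) := by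
  classical
  set e : Fin (n + 1) ⊕ Fin (n + 1) → (Fin (n + 1) ⊕ Fin (n + 1) → ℝ) :=
    fun k => Pi.single k 1 with he
  set c : Fin (n + 1) ⊕ Fin (n + 1) → ExteriorAlgebra ℝ (Fin (n + 1) ⊕ Fin (n + 1) → ℝ) :=
    fun k => ExteriorAlgebra.ι ℝ (e k) with hc
  -- Generators beyond the last pair are set to zero, which keeps the relations valid for all
  -- natural indices.
  set a : ℕ → ExteriorAlgebra ℝ (Fin (n + 1) ⊕ Fin (n + 1) → ℝ) :=
    fun j => if h : j < n + 1 then c (.inl ⟨j, h⟩) else 0 with ha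
  set b : ℕ → ExteriorAlgebra ℝ (Fin (n + 1) ⊕ Fin (n + 1) → ℝ) :=
    fun j => if h : j < n + 1 then c (.inr ⟨j, h⟩) else 0 with hb
  have hcc : ∀ k l, c k * c l = -(c l * c k) := fun k l =>
    eq_neg_of_add_eq_zero_left (ExteriorAlgebra.ι_add_mul_swap _ _)
  have hrel : ExteriorRelations a b := by
    refine ⟨fun i j => ?_, fun i j => ?_, fun i j => ?_, fun i => ?_, fun i => ?_⟩
    · simp only [ha]; split_ifs <;> simp [hcc (.inl ⟨i, _⟩) (.inl ⟨j, _⟩)]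
    · simp only [hb]; split_ifs <;> simp [hcc (.inr ⟨i, _⟩) (.inr ⟨j, _⟩)]
    · simp only [ha, hb]; split_ifs <;> simp [hcc (.inl ⟨i, _⟩) (.inr ⟨j, _⟩)]
    · simp only [ha]; split_ifs <;> simp [hc]
    · simp only [hb]; split_ifs <;> simp [hc]
  have hja : ∀ j : Fin (n + 1), c (.inl j) = a j := fun j => by simp only [ha]; rw [dif_pos j.2]
  have hjb : ∀ j : Fin (n + 1), c (.inr j) = b j := fun j => by simp only [hb]; rw [dif_pos j.2]
  have hword : ∀ (d : ℕ) (l : Fin d → Fin (n + 1) ⊕ Fin (n + 1)),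
      (List.ofFn fun i => c (l i)).prod ∈ pairSpan a b (n + 1) d := by
    intro d
    induction d with
    | zero => intro l; simpa using one_mem_pairSpan (n + 1)
    | succ d ih =>
      intro l
      rw [List.ofFn_succ, List.prod_cons]
      have := ih fun i => l i.succ
      push_cast
      rcases l 0 with j | j
      · rw [hja]
        exact hrel.a_mul_mem j.2 _ this
      · rw [hjb]
        exact hrel.b_mul_mem j.2 _ this
  -- Degree `n + 2` is one above the middle degree of `n + 1` pairs, so exactly one symplectic
  -- factor splits off.
  obtain ⟨u, hu, hκ⟩ := hrel.exists_eq_pairSum_pow_mul (n + 1) 1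
    (List.ofFn fun i => c (κ i)).prod (by
      rw [show ((n + 1 : ℕ) : ℤ) + ((1 : ℕ) : ℤ) = (n + 2 : ℕ) by push_cast; ring]
      exact hword _ κ)
  have hu' : u ∈ Submodule.span ℝ (Set.range c) ^ n := by
    refine (mem_pow_of_mem_pairSpan (fun i => ?_) (fun i => ?_) (n + 1) _ _ hu).1 n
      (by push_cast; ring)
    · simp only [ha]; split_ifs
      exacts [Submodule.subset_span ⟨_, rfl⟩, Submodule.zero_mem _]
    · simp only [hb]; split_ifs
      exacts [Submodule.subset_span ⟨_, rfl⟩, Submodule.zero_mem _]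
  have hrange : Set.range c ^ n
      ⊆ Set.range fun l : Fin n → Fin (n + 1) ⊕ Fin (n + 1) => (List.ofFn fun i => c (l i)).prod := by
    intro v hv
    obtain ⟨f, rfl⟩ := Set.mem_pow.1 hv
    choose g hg using fun i => (f i).2
    exact ⟨g, by simp only [hg]⟩
  rw [Submodule.span_pow] at hu'
  obtain ⟨w, hw⟩ := (Submodule.mem_span_range_iff_exists_fun ℝ).1 (Submodule.span_mono hrange hu')
  -- The weights come from an identity in the exterior algebra, before `ζ` is given. At the use site
  -- this makes them constants rather than functions of the point.
  refine ⟨w, fun ζ => ?_⟩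
  set T : (Fin (n + 1) ⊕ Fin (n + 1) → ℝ) →ₗ[ℝ] (Fin (n + 2) → ℝ) := Fintype.linearCombination ℝ ζ
    with hT
  have hTe : ∀ k, T (e k) = ζ k := fun k => by simp [hT, he, Fintype.linearCombination_apply_single]
  -- A linear functional on the exterior algebra is given by one alternating form per degree: here
  -- the pulled back determinant in degree `n + 2`, zero elsewhere.
  set D : (i : ℕ) → (Fin (n + 1) ⊕ Fin (n + 1) → ℝ) [⋀^Fin i]→ₗ[ℝ] ℝ := fun i =>
    if h : i = n + 2 then h ▸ (Matrix.detRowAlternating.compLinearMap T) else 0 with hD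
  have hDv : ∀ v : Fin (n + 2) → (Fin (n + 1) ⊕ Fin (n + 1) → ℝ),
      ExteriorAlgebra.liftAlternating D (List.ofFn fun i => ExteriorAlgebra.ι ℝ (v i)).prod
        = Matrix.detRowAlternating fun i => T (v i) := by
    intro v
    rw [← ExteriorAlgebra.ιMulti_apply, ExteriorAlgebra.liftAlternating_apply_ιMulti]
    simp [hD]
  have h1 := hDv fun i => e (κ i)
  simp only [hTe] at h1
  rw [← h1]
  change ExteriorAlgebra.liftAlternating D (List.ofFn fun i => c (κ i)).prod = _
  rw [hκ, pow_one, ← hw, Finset.mul_sum, map_sum]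
  refine Finset.sum_congr rfl fun l _ => ?_
  rw [mul_smul_comm, map_smul, smul_eq_mul, pairSum, Finset.sum_mul, map_sum,
    ← Fin.sum_univ_eq_sum_range
      (fun j => ExteriorAlgebra.liftAlternating D (a j * b j * (List.ofFn fun i => c (l i)).prod))]
  congr 1
  refine Finset.sum_congr rfl fun j _ => ?_
  have h2 := hDv (Matrix.vecCons (e (.inl j)) (Matrix.vecCons (e (.inr j)) fun i => e (l i)))
  have h3 : a j * b j * (List.ofFn fun i => c (l i)).prod = (List.ofFn fun i => ExteriorAlgebra.ι ℝ
      ((Matrix.vecCons (e (.inl j)) (Matrix.vecCons (e (.inr j)) fun i => e (l i)) :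
        Fin (n + 2) → Fin (n + 1) ⊕ Fin (n + 1) → ℝ) i)).prod := by
    rw [List.ofFn_succ, List.ofFn_succ, ← hja, ← hjb]
    simp [hc, mul_assoc]
  rw [h3, h2]
  congr 1
  funext i
  refine Fin.cases ?_ (fun i => Fin.cases ?_ (fun i => ?_) i) i <;> simp [hTe]

/-! ### Size of determinants and of integrals -/

theorem abs_detRow_le {N : ℕ} {r : Fin N → Fin N → ℝ} {ρ : Fin N → ℝ}
    (h : ∀ i l, |r i l| ≤ ρ i) :
    |Matrix.detRowAlternating r| ≤ N.factorial * ∏ i, ρ i := by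
  rw [detRow_apply]
  calc _ ≤ ∑ σ : Equiv.Perm (Fin N), |((Equiv.Perm.sign σ : ℤ) : ℝ) * ∏ i, r i (σ i)| :=
        Finset.abs_sum_le_sum_abs _ _
    _ ≤ ∑ _σ : Equiv.Perm (Fin N), ∏ i, ρ i := by
        refine Finset.sum_le_sum fun σ _ => ?_
        have h1 : |((Equiv.Perm.sign σ : ℤ) : ℝ)| = 1 := by
          rcases Int.units_eq_one_or (Equiv.Perm.sign σ) with h | h <;> simp [h]
        rw [abs_mul, h1, one_mul, Finset.abs_prod]
        exact Finset.prod_le_prod (fun _ _ => abs_nonneg _) fun i _ => h i _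
    _ = _ := by simp [Fintype.card_perm]

theorem abs_integral_le_of_support_ball {N : ℕ} {f : (Fin N → ℝ) → ℝ} {C R : ℝ} (hR : 0 ≤ R)
    (hf : ∀ x, |f x| ≤ C) (hs : ∀ x, R < ‖x‖ → f x = 0) :
    |∫ x, f x| ≤ C * (2 * R) ^ N := by
  have h1 : ∫ x in Metric.closedBall (0 : Fin N → ℝ) R, f x = ∫ x, f x :=
    setIntegral_eq_integral_of_forall_compl_eq_zero fun x hx =>
      hs x (by simpa using hx)
  have hv : volume (Metric.closedBall (0 : Fin N → ℝ) R) = ENNReal.ofReal ((2 * R) ^ N) := by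
    rw [Real.volume_pi_closedBall _ hR, Fintype.card_fin]
  rw [← h1]
  have h2 := norm_setIntegral_le_of_norm_le_const (μ := volume)
    (s := Metric.closedBall (0 : Fin N → ℝ) R) (f := f) (C := C) (by rw [hv]; exact ENNReal.ofReal_lt_top)
    (fun x _ => hf x)
  rwa [Measure.real, hv, ENNReal.toReal_ofReal (by positivity), Real.norm_eq_abs] at h2

theorem alternatingMap_sum_apply {κ ι M : Type*} [AddCommGroup M] [Module ℝ M] (s : Finset κ)
    (f : κ → M [⋀^ι]→ₗ[ℝ] ℝ) (v : ι → M) : (∑ k ∈ s, f k) v = ∑ k ∈ s, f k v := by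
  classical
  induction s using Finset.induction_on with
  | empty => simp
  | insert a s ha ih => rw [Finset.sum_insert ha, Finset.sum_insert ha, AlternatingMap.add_apply, ih]

/-! ### The contact form and integration by parts -/

section Contact

variable {n : ℕ}

/-- The coefficients of the linear form `2 ∑ (y_j dx_j - x_j dy_j)` at a point with horizontal
coordinates `w`. -/
def dualCoeff (w : Fin n ⊕ Fin n → ℝ) : Fin n ⊕ Fin n → ℝ
  | .inl j => 2 * w (.inr j)
  | .inr j => -(2 * w (.inl j))

/-- The pullback of the contact form under the map with horizontal coordinates `z` and vertical
coordinate `t`. -/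
noncomputable def contactRow {ι : Type*} [DecidableEq ι] [Fintype ι]
    (z : Fin n ⊕ Fin n → (ι → ℝ) → ℝ) (t : (ι → ℝ) → ℝ) (x : ι → ℝ) : ι → ℝ :=
  grad t x - ∑ k, dualCoeff (fun k => z k x) k • grad (z k) x

theorem contDiff_dualCoeff {E : Type*} [NormedAddCommGroup E] [NormedSpace ℝ E]
    {w : E → Fin n ⊕ Fin n → ℝ} (hw : ContDiff ℝ ∞ w) (k : Fin n ⊕ Fin n) :
    ContDiff ℝ ∞ fun x => dualCoeff (w x) k := by
  have h := contDiff_pi.1 hw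
  rcases k with j | j
  · exact contDiff_const.mul (h _)
  · exact (contDiff_const.mul (h _)).neg

theorem continuous_contactRow {ι : Type*} [DecidableEq ι] [Fintype ι]
    {z : Fin n ⊕ Fin n → (ι → ℝ) → ℝ} {t : (ι → ℝ) → ℝ} (hz : ∀ k, ContDiff ℝ ∞ (z k))
    (ht : ContDiff ℝ ∞ t) : Continuous (contactRow z t) :=
  (continuous_grad ht).sub (continuous_finsetSum _ fun k _ =>
    (contDiff_dualCoeff (contDiff_pi.2 hz) k).continuous.smul (continuous_grad (hz k)))

variable {m : ℕ}

/-- The determinant of the gradients of `p`, `q` and the `v i`. -/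
noncomputable def jacCons (v : Fin m → (Fin (m + 2) → ℝ) → ℝ) (p q : (Fin (m + 2) → ℝ) → ℝ)
    (x : Fin (m + 2) → ℝ) : ℝ :=
  Matrix.detRowAlternating
    (Matrix.vecCons (grad p x) (Matrix.vecCons (grad q x) fun i => grad (v i) x))

theorem jacCons_eq_jac (v : Fin m → (Fin (m + 2) → ℝ) → ℝ) (p q : (Fin (m + 2) → ℝ) → ℝ)
    (x : Fin (m + 2) → ℝ) :
    jacCons v p q x = jac (Matrix.vecCons p (Matrix.vecCons q v)) x := by
  unfold jacCons jac
  congr 1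
  funext i
  refine Fin.cases ?_ (fun i => Fin.cases ?_ (fun i => ?_) i) i <;> simp

theorem detRow_vecCons_swap (a b : Fin (m + 2) → ℝ) (r : Fin m → Fin (m + 2) → ℝ) :
    Matrix.detRowAlternating (Matrix.vecCons a (Matrix.vecCons b r))
      = -Matrix.detRowAlternating (Matrix.vecCons b (Matrix.vecCons a r)) := by
  rw [← AlternatingMap.map_swap _ _ (show (0 : Fin (m + 2)) ≠ 1 by simp)]
  congr 1
  funext i
  refine Fin.cases ?_ (fun i => Fin.cases ?_ (fun i => ?_) i) i
  · simp
  · simp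
  · rw [Function.comp_apply, Equiv.swap_apply_of_ne_of_ne]
    · simp
    · exact Fin.succ_ne_zero _
    · intro h
      exact Fin.succ_ne_zero i (Fin.succ_injective _ (h.trans Fin.succ_zero_eq_one.symm))

theorem contDiff_vecCons {v : Fin m → (Fin (m + 2) → ℝ) → ℝ} {p q : (Fin (m + 2) → ℝ) → ℝ}
    (hv : ∀ i, ContDiff ℝ ∞ (v i)) (hp : ContDiff ℝ ∞ p) (hq : ContDiff ℝ ∞ q) (i : Fin (m + 2)) :
    ContDiff ℝ ∞ ((Matrix.vecCons p (Matrix.vecCons q v) :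
      Fin (m + 2) → (Fin (m + 2) → ℝ) → ℝ) i) := by
  refine Fin.cases ?_ (fun i => Fin.cases ?_ (fun i => ?_) i) i
  · simpa using hp
  · simpa using hq
  · simpa using hv i

theorem continuous_jacCons {v : Fin m → (Fin (m + 2) → ℝ) → ℝ} {p q : (Fin (m + 2) → ℝ) → ℝ}
    (hv : ∀ i, ContDiff ℝ ∞ (v i)) (hp : ContDiff ℝ ∞ p) (hq : ContDiff ℝ ∞ q) :
    Continuous (jacCons v p q) := by
  have := continuous_jac (contDiff_vecCons hv hp hq)
  exact this.congr fun x => (jacCons_eq_jac v p q x).symm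

theorem hasCompactSupport_jacCons {v : Fin m → (Fin (m + 2) → ℝ) → ℝ}
    {p q : (Fin (m + 2) → ℝ) → ℝ} (hc : HasCompactSupport p) :
    HasCompactSupport (jacCons v p q) := by
  refine HasCompactSupport.intro' hc (isClosed_tsupport _) fun x hx => ?_
  exact AlternatingMap.map_coord_zero _ 0 (by simp [grad_eq_zero_of_notMem_tsupport hx])

theorem integral_jacCons_eq_zero {v : Fin m → (Fin (m + 2) → ℝ) → ℝ}
    {p q : (Fin (m + 2) → ℝ) → ℝ} (hv : ∀ i, ContDiff ℝ ∞ (v i)) (hp : ContDiff ℝ ∞ p)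
    (hq : ContDiff ℝ ∞ q) (hc : HasCompactSupport p) : ∫ x, jacCons v p q x = 0 := by
  simp only [jacCons_eq_jac]
  exact integral_jac_eq_zero (contDiff_vecCons hv hp hq) 0 (by simpa using hc)

/-- The Jacobian with first function `c * f` integrates to zero, and the Leibniz rule splits it into
the two sides. Compact support of `c` alone suffices. -/
theorem integral_mul_jacCons {v : Fin m → (Fin (m + 2) → ℝ) → ℝ}
    {c f q : (Fin (m + 2) → ℝ) → ℝ} (hv : ∀ i, ContDiff ℝ ∞ (v i)) (hc : ContDiff ℝ ∞ c)
    (hf : ContDiff ℝ ∞ f) (hq : ContDiff ℝ ∞ q) (hcs : HasCompactSupport c) :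
    ∫ x, f x * jacCons v c q x = -∫ x, c x * jacCons v f q x := by
  have h1 := integral_jacCons_eq_zero hv (hc.mul hf) hq hcs.mul_right
  have h2 : ∀ x, jacCons v (fun y => c y * f y) q x
      = c x * jacCons v f q x + f x * jacCons v c q x := by
    intro x
    unfold jacCons
    simp only [← AlternatingMap.curryLeft_apply_apply, grad_mul hc hf]
    simp
  simp only [h2] at h1
  rw [integral_add] at h1
  · linarith
  · exact (hc.continuous.mul (continuous_jacCons hv hf hq)).integrable_of_hasCompactSupport
      hcs.mul_right
  · exact (hf.continuous.mul (continuous_jacCons hv hc hq)).integrable_of_hasCompactSupport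
      (hasCompactSupport_jacCons hcs).mul_left

/-- Integration by parts moves the exterior derivative of the contact form onto the coefficient. -/
theorem integral_sum_pairs_eq {z : Fin n ⊕ Fin n → (Fin (m + 2) → ℝ) → ℝ}
    {t c : (Fin (m + 2) → ℝ) → ℝ} {v : Fin m → (Fin (m + 2) → ℝ) → ℝ}
    (hz : ∀ k, ContDiff ℝ ∞ (z k)) (ht : ContDiff ℝ ∞ t) (hc : ContDiff ℝ ∞ c)
    (hv : ∀ i, ContDiff ℝ ∞ (v i)) (hcs : HasCompactSupport c) :
    ∑ j, ∫ x, c x * jacCons v (z (.inl j)) (z (.inr j)) x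
      = -(1 / 4) * ∫ x, Matrix.detRowAlternating (Matrix.vecCons (grad c x)
          (Matrix.vecCons (contactRow z t x) fun i => grad (v i) x)) := by
  -- The `dt` part of the contact row yields an exact integrand with compactly supported `c`, so
  -- only the horizontal part survives.
  have h1 : ∀ x, Matrix.detRowAlternating (Matrix.vecCons (grad c x)
      (Matrix.vecCons (contactRow z t x) fun i => grad (v i) x))
      = jacCons v c t x - ∑ k, dualCoeff (fun k => z k x) k * jacCons v c (z k) x := by
    intro x
    unfold jacCons contactRow
    simp only [← AlternatingMap.curryLeft_apply_apply]
    rw [map_sub, map_sum]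
    rw [AlternatingMap.sub_apply, alternatingMap_sum_apply]
    simp only [map_smul, AlternatingMap.smul_apply, smul_eq_mul]
  have hcd : ∀ k, ContDiff ℝ ∞ fun x => dualCoeff (fun k => z k x) k := fun k =>
    contDiff_dualCoeff (contDiff_pi.2 hz) k
  have hi : ∀ k, Integrable fun x => dualCoeff (fun k => z k x) k * jacCons v c (z k) x := fun k =>
    ((hcd k).continuous.mul (continuous_jacCons hv hc (hz k))).integrable_of_hasCompactSupport
      (hasCompactSupport_jacCons hcs).mul_left
  simp only [h1]
  rw [integral_sub ((continuous_jacCons hv hc ht).integrable_of_hasCompactSupport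
      (hasCompactSupport_jacCons hcs)) (integrable_finsetSum _ fun k _ => hi k),
    integral_jacCons_eq_zero hv hc ht hcs, integral_finsetSum _ fun k _ => hi k,
    Fintype.sum_sum_type, ← Finset.sum_add_distrib, zero_sub, neg_mul_neg, Finset.mul_sum]
  refine Finset.sum_congr rfl fun j _ => ?_
  rw [integral_mul_jacCons hv hc (hcd _) (hz _) hcs, integral_mul_jacCons hv hc (hcd _) (hz _) hcs]
  -- Both halves of the dual coefficients, `2 y_j` against `x_j` and `-2 x_j` against `y_j`, produce
  -- `-2` times the same Jacobian; together they account for the `1 / 4`.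
  have e1 : ∀ x, c x * jacCons v (fun x => dualCoeff (fun k => z k x) (.inl j)) (z (.inl j)) x
      = -2 * (c x * jacCons v (z (.inl j)) (z (.inr j)) x) := by
    intro x
    have : (fun x => dualCoeff (fun k => z k x) (.inl j)) = fun x => (2 : ℝ) * z (.inr j) x := rfl
    rw [this]
    unfold jacCons
    rw [grad_mul contDiff_const (hz _), detRow_vecCons_swap (grad (z (.inl j)) x)]
    simp only [← AlternatingMap.curryLeft_apply_apply]
    have h0 : grad (fun _ : Fin (m + 2) → ℝ => (2 : ℝ)) x = 0 := by ext l; simp [grad]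
    simp [h0]
    ring
  have e2 : ∀ x, c x * jacCons v (fun x => dualCoeff (fun k => z k x) (.inr j)) (z (.inr j)) x
      = -2 * (c x * jacCons v (z (.inl j)) (z (.inr j)) x) := by
    intro x
    have : (fun x => dualCoeff (fun k => z k x) (.inr j)) = fun x => (-2 : ℝ) * z (.inl j) x := by
      funext x; simp [dualCoeff]
    rw [this]
    unfold jacCons
    rw [grad_mul contDiff_const (hz _)]
    simp only [← AlternatingMap.curryLeft_apply_apply]
    have h0 : grad (fun _ : Fin (m + 2) → ℝ => (-2 : ℝ)) x = 0 := by ext l; simp [grad]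
    simp [h0]
    ring
  simp only [e1, e2, integral_const_mul]
  ring

end Contact

/-! ### Smallness of the integrated Jacobian -/

section Smallness

variable {n : ℕ}

/-- The coefficients of the differential of `g` in the coframe formed by the contact form (index
`none`) and the differentials of the horizontal coordinates. -/
noncomputable def coframeCoeff (g : (Fin n ⊕ Fin n → ℝ) × ℝ → ℝ) :
    Option (Fin n ⊕ Fin n) → (Fin n ⊕ Fin n → ℝ) × ℝ → ℝ
  | none, w => fderiv ℝ g w (0, 1)
  -- The second summand comes from eliminating `dt`, which is the contact form plus the horizontal
  -- form with coefficients `dualCoeff`.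
  | some k, w => fderiv ℝ g w (Pi.single k 1, 0) + dualCoeff w.1 k * fderiv ℝ g w (0, 1)

/-- The pullback of the coframe. -/
noncomputable def coframeRow {ι : Type*} [DecidableEq ι] [Fintype ι]
    (z : Fin n ⊕ Fin n → (ι → ℝ) → ℝ) (t : (ι → ℝ) → ℝ) :
    Option (Fin n ⊕ Fin n) → (ι → ℝ) → ι → ℝ
  | none, x => contactRow z t x
  | some k, x => grad (z k) x

theorem contDiff_coframeCoeff {g : (Fin n ⊕ Fin n → ℝ) × ℝ → ℝ} (hg : ContDiff ℝ ∞ g)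
    (o : Option (Fin n ⊕ Fin n)) : ContDiff ℝ ∞ (coframeCoeff g o) := by
  have h : ∀ v, ContDiff ℝ ∞ fun w => fderiv ℝ g w v := fun v =>
    (hg.fderiv_right (m := ∞) (by simp)).clm_apply contDiff_const
  rcases o with _ | k
  · exact h _
  · exact (h _).add ((contDiff_dualCoeff contDiff_fst k).mul (h _))

theorem coframeCoeff_eq_zero {g : (Fin n ⊕ Fin n → ℝ) × ℝ → ℝ} {w : (Fin n ⊕ Fin n → ℝ) × ℝ}
    (h : fderiv ℝ g w = 0) (o : Option (Fin n ⊕ Fin n)) : coframeCoeff g o w = 0 := by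
  rcases o with _ | k <;> simp [coframeCoeff, h]

theorem continuous_coframeRow {ι : Type*} [DecidableEq ι] [Fintype ι]
    {z : Fin n ⊕ Fin n → (ι → ℝ) → ℝ} {t : (ι → ℝ) → ℝ} (hz : ∀ k, ContDiff ℝ ∞ (z k))
    (ht : ContDiff ℝ ∞ t) (o : Option (Fin n ⊕ Fin n)) : Continuous (coframeRow z t o) := by
  rcases o with _ | k
  · exact continuous_contactRow hz ht
  · exact continuous_grad (hz k)

theorem contDiff_coords {ι : Type*} [Fintype ι]
    {z : Fin n ⊕ Fin n → (ι → ℝ) → ℝ} {t : (ι → ℝ) → ℝ} (hz : ∀ k, ContDiff ℝ ∞ (z k))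
    (ht : ContDiff ℝ ∞ t) :
    ContDiff ℝ ∞ fun x => ((fun k => z k x, t x) : (Fin n ⊕ Fin n → ℝ) × ℝ) :=
  (contDiff_pi.2 hz).prodMk ht

/-- The chain rule in terms of the coframe. -/
theorem grad_comp_coords {ι : Type*} [DecidableEq ι] [Fintype ι]
    {z : Fin n ⊕ Fin n → (ι → ℝ) → ℝ} {t : (ι → ℝ) → ℝ} (hz : ∀ k, ContDiff ℝ ∞ (z k))
    (ht : ContDiff ℝ ∞ t) {g : (Fin n ⊕ Fin n → ℝ) × ℝ → ℝ} (hg : ContDiff ℝ ∞ g) (x : ι → ℝ) :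
    grad (fun x => g (fun k => z k x, t x)) x
      = ∑ o, coframeCoeff g o (fun k => z k x, t x) • coframeRow z t o x := by
  ext l
  have hzd : ∀ k, DifferentiableAt ℝ (z k) x := fun k => (hz k).differentiable (by simp) x
  have htd : DifferentiableAt ℝ t x := ht.differentiable (by simp) x
  have hd : HasFDerivAt (fun x => ((fun k => z k x, t x) : (Fin n ⊕ Fin n → ℝ) × ℝ))
      ((ContinuousLinearMap.pi fun k => fderiv ℝ (z k) x).prod (fderiv ℝ t x)) x :=
    (hasFDerivAt_pi.2 fun k => (hzd k).hasFDerivAt).prodMk htd.hasFDerivAt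
  have hgd : HasFDerivAt g (fderiv ℝ g (fun k => z k x, t x)) (fun k => z k x, t x) :=
    (hg.differentiable (by simp) _).hasFDerivAt
  have h1 : grad (fun x => g (fun k => z k x, t x)) x l
      = fderiv ℝ g (fun k => z k x, t x) (fun k => grad (z k) x l, grad t x l) := by
    have h := (hgd.comp x hd).fderiv
    simp only [Function.comp_def] at h
    rw [grad, h]
    rfl
  have h2 : ((fun k => grad (z k) x l, grad t x l) : (Fin n ⊕ Fin n → ℝ) × ℝ)
      = ∑ k, grad (z k) x l • ((Pi.single k 1, 0) : (Fin n ⊕ Fin n → ℝ) × ℝ)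
        + grad t x l • ((0, 1) : (Fin n ⊕ Fin n → ℝ) × ℝ) := by
    refine Prod.ext ?_ ?_
    · ext k
      simp only [Prod.fst_add, Prod.fst_sum, Prod.smul_fst, smul_zero, add_zero, Finset.sum_apply,
        Pi.smul_apply, Pi.single_apply, smul_eq_mul, mul_ite, mul_one, mul_zero]
      simp
    · simp [Prod.snd_sum]
  rw [h1, h2, map_add, map_sum, Fintype.sum_option]
  simp only [map_smul, smul_eq_mul, Pi.add_apply, Finset.sum_apply, Pi.smul_apply, coframeCoeff,
    coframeRow, contactRow, Pi.sub_apply, add_mul, Finset.sum_add_distrib, mul_sub, Finset.mul_sum]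
  have h3 : ∀ k, dualCoeff (fun k => z k x) k * fderiv ℝ g (fun k => z k x, t x) (0, 1)
      * grad (z k) x l
      = fderiv ℝ g (fun k => z k x, t x) (0, 1) * (dualCoeff (fun k => z k x) k * grad (z k) x l) :=
    fun k => by ring
  simp only [h3, mul_comm (fderiv ℝ g (fun k => z k x, t x) (Pi.single _ 1, 0))]
  ring

/-- The size of the coframe rows. -/
def rowBound (δ : ℝ) : Option (Fin n ⊕ Fin n) → ℝ
  | none => δ ^ 2
  | some _ => δ

theorem rowBound_nonneg {δ : ℝ} (h0 : 0 ≤ δ) (o : Option (Fin n ⊕ Fin n)) : 0 ≤ rowBound δ o := by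
  rcases o with _ | k <;> simp only [rowBound] <;> positivity

theorem rowBound_le {δ : ℝ} (h0 : 0 ≤ δ) (h1 : δ ≤ 1) (o : Option (Fin n ⊕ Fin n)) :
    rowBound δ o ≤ δ := by
  rcases o with _ | k <;> simp only [rowBound]
  · nlinarith
  · exact le_rfl

/-- Functions bounded by `M` whose horizontal gradients are at most `δ` and whose contact row is at
most `δ ^ 2`. -/
structure AlmostHorizontal {N : ℕ} (z : Fin n ⊕ Fin n → (Fin N → ℝ) → ℝ) (t : (Fin N → ℝ) → ℝ)
    (M δ : ℝ) : Prop where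
  contDiff_z : ∀ k, ContDiff ℝ ∞ (z k)
  contDiff_t : ContDiff ℝ ∞ t
  norm_le : ∀ x, ‖((fun k => z k x, t x) : (Fin n ⊕ Fin n → ℝ) × ℝ)‖ ≤ M
  abs_grad_le : ∀ k x l, |grad (z k) x l| ≤ δ
  abs_contactRow_le : ∀ x l, |contactRow z t x l| ≤ δ ^ 2

theorem AlmostHorizontal.abs_coframeRow_le {N : ℕ} {z : Fin n ⊕ Fin n → (Fin N → ℝ) → ℝ}
    {t : (Fin N → ℝ) → ℝ} {M δ : ℝ} (h : AlmostHorizontal z t M δ) (o : Option (Fin n ⊕ Fin n))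
    (x : Fin N → ℝ) (l : Fin N) : |coframeRow z t o x l| ≤ rowBound δ o := by
  rcases o with _ | k
  · exact h.abs_contactRow_le x l
  · exact h.abs_grad_le k x l

theorem exists_bound_of_continuous {E : Type*} [NormedAddCommGroup E] [ProperSpace E] {f : E → ℝ}
    (hf : Continuous f) (M : ℝ) : ∃ C, 0 ≤ C ∧ ∀ w, ‖w‖ ≤ M → |f w| ≤ C := by
  obtain ⟨C, hC⟩ := (isCompact_closedBall (0 : E) M).exists_bound_of_continuousOn hf.continuousOn
  exact ⟨max C 0, le_max_right _ _, fun w hw =>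
    (hC w (by simpa using hw)).trans (le_max_left _ _)⟩

/-- A term of the expansion in which the contact form occurs. -/
theorem exists_bound_of_none (C : (Fin n ⊕ Fin n → ℝ) × ℝ → ℝ) (hC : ContDiff ℝ ∞ C) (M : ℝ)
    (κ : Fin (n + 1) → Option (Fin n ⊕ Fin n)) (hκ : ∃ i, κ i = none) :
    ∃ K, 0 ≤ K ∧ ∀ (z : Fin n ⊕ Fin n → (Fin (n + 1) → ℝ) → ℝ) (t : (Fin (n + 1) → ℝ) → ℝ)
      (δ R : ℝ), 0 ≤ δ → δ ≤ 1 → 0 ≤ R → AlmostHorizontal z t M δ →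
      (∀ x, R ≤ ‖x‖ → C (fun k => z k x, t x) = 0) →
      |∫ x, C (fun k => z k x, t x) * Matrix.detRowAlternating fun i => coframeRow z t (κ i) x|
        ≤ K * (δ ^ (n + 2) * R ^ (n + 1)) := by
  obtain ⟨B, hB0, hB⟩ := exists_bound_of_continuous hC.continuous M
  refine ⟨B * (n + 1).factorial * 2 ^ (n + 1), by positivity, ?_⟩
  intro z t δ R h0 h1 hR hV hs
  obtain ⟨i₀, hi₀⟩ := hκ
  -- One contact row contributes `δ ^ 2`, the `n` others at most `δ` each.
  have hprod : ∏ i, rowBound δ (κ i) ≤ δ ^ (n + 2) := by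
    rw [← Finset.mul_prod_erase _ _ (Finset.mem_univ i₀), hi₀]
    have : ∏ i ∈ Finset.univ.erase i₀, rowBound δ (κ i) ≤ ∏ i ∈ Finset.univ.erase i₀, δ :=
      Finset.prod_le_prod (fun i _ => rowBound_nonneg h0 _) fun i _ => rowBound_le h0 h1 _
    rw [Finset.prod_const, Finset.card_erase_of_mem (Finset.mem_univ _), Finset.card_univ,
      Fintype.card_fin, Nat.add_sub_cancel] at this
    calc _ ≤ δ ^ 2 * δ ^ n := mul_le_mul_of_nonneg_left this (by positivity)
      _ = δ ^ (n + 2) := by ring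
  have h2 := abs_integral_le_of_support_ball (N := n + 1) (R := R)
    (f := fun x => C (fun k => z k x, t x) *
      Matrix.detRowAlternating fun i => coframeRow z t (κ i) x)
    (C := B * ((n + 1).factorial * δ ^ (n + 2))) hR
    (fun x => by
      rw [abs_mul]
      refine mul_le_mul (hB _ (hV.norm_le x)) ?_ (abs_nonneg _) hB0
      exact (abs_detRow_le fun i l => hV.abs_coframeRow_le (κ i) x l).trans
        (mul_le_mul_of_nonneg_left hprod (by positivity)))
    (fun x hx => by rw [hs x hx.le, zero_mul])
  refine h2.trans (le_of_eq ?_)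
  rw [mul_pow]
  ring

/-- A term of the expansion in which only horizontal differentials occur. -/
theorem exists_bound_of_some (C : (Fin (n + 1) ⊕ Fin (n + 1) → ℝ) × ℝ → ℝ) (hC : ContDiff ℝ ∞ C)
    (M : ℝ) (κ : Fin (n + 2) → Fin (n + 1) ⊕ Fin (n + 1)) :
    ∃ K, 0 ≤ K ∧ ∀ (z : Fin (n + 1) ⊕ Fin (n + 1) → (Fin (n + 2) → ℝ) → ℝ)
      (t : (Fin (n + 2) → ℝ) → ℝ) (δ R : ℝ), 0 ≤ δ → δ ≤ 1 → 0 ≤ R → AlmostHorizontal z t M δ →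
      (∀ x, R ≤ ‖x‖ → C (fun k => z k x, t x) = 0) →
      |∫ x, C (fun k => z k x, t x) * Matrix.detRowAlternating fun i => grad (z (κ i)) x|
        ≤ K * (δ ^ (n + 3) * R ^ (n + 2)) := by
  -- No contact row is present, so the direct estimate misses one power of `δ`. Lefschetz exposes
  -- the symplectic form, and integration by parts recovers that power.
  obtain ⟨w, hw⟩ := exists_detRow_eq_sum_pairs κ
  choose B hB0 hB using fun o => exists_bound_of_continuous (contDiff_coframeCoeff hC o).continuous M
  refine ⟨∑ l, |w l| * (1 / 4 * ((n + 2).factorial * (∑ o, B o) * 2 ^ (n + 2))),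
    Finset.sum_nonneg fun l _ => mul_nonneg (abs_nonneg _) (mul_nonneg (by norm_num)
      (mul_nonneg (mul_nonneg (by positivity) (Finset.sum_nonneg fun o _ => hB0 o))
        (by positivity))), ?_⟩
  intro z t δ R h0 h1 hR hV hs
  set c : (Fin (n + 2) → ℝ) → ℝ := fun x => C (fun k => z k x, t x) with hc
  have hcd : ContDiff ℝ ∞ c := hC.comp (contDiff_coords hV.contDiff_z hV.contDiff_t)
  have hcs : HasCompactSupport c :=
    HasCompactSupport.intro (isCompact_closedBall (0 : Fin (n + 2) → ℝ) R) fun x hx =>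
      hs x (by simpa using (not_le.1 (by simpa using hx)).le)
  have hgc : ∀ x, R < ‖x‖ → grad c x = 0 := by
    intro x hx
    refine grad_eq_zero_of_notMem_tsupport (notMem_tsupport_iff_eventuallyEq.2 ?_)
    filter_upwards [continuous_norm.continuousAt.eventually (lt_mem_nhds hx)] with y hy
    exact hs y (le_of_lt hy)
  -- The coefficient depends on the point only through the map, so its gradient also gains a factor
  -- `δ`.
  have hgb : ∀ x l, |grad c x l| ≤ (∑ o, B o) * δ := by
    intro x l
    rw [hc, grad_comp_coords hV.contDiff_z hV.contDiff_t hC, Finset.sum_apply, Finset.sum_mul]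
    refine (Finset.abs_sum_le_sum_abs _ _).trans (Finset.sum_le_sum fun o _ => ?_)
    rw [Pi.smul_apply, smul_eq_mul, abs_mul]
    exact mul_le_mul (hB o _ (hV.norm_le x)) ((hV.abs_coframeRow_le o x l).trans
      (rowBound_le h0 h1 o)) (abs_nonneg _) (hB0 o)
  have hint : ∀ (l : Fin n → Fin (n + 1) ⊕ Fin (n + 1)) (j : Fin (n + 1)), Integrable fun x =>
      c x * jacCons (fun i => z (l i)) (z (.inl j)) (z (.inr j)) x :=
    fun l j => (hcd.continuous.mul (continuous_jacCons (fun i => hV.contDiff_z _)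
      (hV.contDiff_z _) (hV.contDiff_z _))).integrable_of_hasCompactSupport hcs.mul_right
  have hexp : ∀ x, c x * Matrix.detRowAlternating (fun i => grad (z (κ i)) x)
      = ∑ l, w l * ∑ j, c x * jacCons (fun i => z (l i)) (z (.inl j)) (z (.inr j)) x := by
    intro x
    rw [hw fun k => grad (z k) x, Finset.mul_sum]
    refine Finset.sum_congr rfl fun l _ => ?_
    rw [← Finset.mul_sum, mul_left_comm]
    rfl
  change |∫ x, c x * Matrix.detRowAlternating (fun i => grad (z (κ i)) x)| ≤ _
  simp only [hexp]
  rw [integral_finsetSum _ fun l _ => (integrable_finsetSum _ fun j _ => hint l j).const_mul _,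
    Finset.sum_mul]
  refine (Finset.abs_sum_le_sum_abs _ _).trans (Finset.sum_le_sum fun l _ => ?_)
  rw [integral_const_mul, integral_finsetSum _ fun j _ => hint l j,
    integral_sum_pairs_eq hV.contDiff_z hV.contDiff_t hcd (fun i => hV.contDiff_z _) hcs, abs_mul,
    mul_assoc |w l|, abs_mul, mul_assoc (1 / 4 : ℝ)]
  refine mul_le_mul_of_nonneg_left ?_ (abs_nonneg _)
  rw [show |(-(1 / 4) : ℝ)| = 1 / 4 by norm_num]
  refine mul_le_mul_of_nonneg_left ?_ (by norm_num)
  have h2 := abs_integral_le_of_support_ball (N := n + 2) (R := R)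
    (f := fun x => Matrix.detRowAlternating (Matrix.vecCons (grad c x)
      (Matrix.vecCons (contactRow z t x) fun i => grad (z (l i)) x)))
    (C := (n + 2).factorial * ((∑ o, B o) * δ * (δ ^ 2 * δ ^ n))) hR
    (fun x => by
      have := abs_detRow_le (r := Matrix.vecCons (grad c x)
        (Matrix.vecCons (contactRow z t x) fun i => grad (z (l i)) x))
        (ρ := Matrix.vecCons ((∑ o, B o) * δ) (Matrix.vecCons (δ ^ 2) fun _ : Fin n => δ))
        (fun i s => by
          refine Fin.cases ?_ (fun i => Fin.cases ?_ (fun i => ?_) i) i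
          · simpa using hgb x s
          · simpa using hV.abs_contactRow_le x s
          · simpa using hV.abs_grad_le _ x s)
      simpa [Fin.prod_univ_succ] using this)
    (fun x hx => AlternatingMap.map_coord_zero _ 0 (by simp [hgc x hx]))
  refine h2.trans (le_of_eq ?_)
  rw [mul_pow]
  ring

/-- The Jacobian of an almost horizontal map followed by smooth functions has a small integral. -/
theorem exists_bound_integral_jac (g : Fin (n + 1) → (Fin n ⊕ Fin n → ℝ) × ℝ → ℝ)
    (hg : ∀ i, ContDiff ℝ ∞ (g i)) (M : ℝ) :
    ∃ K, 0 ≤ K ∧ ∀ (z : Fin n ⊕ Fin n → (Fin (n + 1) → ℝ) → ℝ) (t : (Fin (n + 1) → ℝ) → ℝ)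
      (δ R : ℝ), 0 ≤ δ → δ ≤ 1 → 0 ≤ R → AlmostHorizontal z t M δ →
      (∀ x, R ≤ ‖x‖ → ∃ i, fderiv ℝ (g i) (fun k => z k x, t x) = 0) →
      |∫ x, jac (fun i x => g i (fun k => z k x, t x)) x| ≤ K * (δ ^ (n + 2) * R ^ (n + 1)) := by
  set C : (Fin (n + 1) → Option (Fin n ⊕ Fin n)) → (Fin n ⊕ Fin n → ℝ) × ℝ → ℝ :=
    fun κ w => ∏ i, coframeCoeff (g i) (κ i) w with hCdef
  have hC : ∀ κ, ContDiff ℝ ∞ (C κ) := fun κ => contDiff_prod fun i _ =>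
    contDiff_coframeCoeff (hg i) _
  have key : ∀ κ : Fin (n + 1) → Option (Fin n ⊕ Fin n), ∃ K, 0 ≤ K ∧
      ∀ (z : Fin n ⊕ Fin n → (Fin (n + 1) → ℝ) → ℝ) (t : (Fin (n + 1) → ℝ) → ℝ)
      (δ R : ℝ), 0 ≤ δ → δ ≤ 1 → 0 ≤ R → AlmostHorizontal z t M δ →
      (∀ x, R ≤ ‖x‖ → C κ (fun k => z k x, t x) = 0) →
      |∫ x, C κ (fun k => z k x, t x) * Matrix.detRowAlternating fun i => coframeRow z t (κ i) x|
        ≤ K * (δ ^ (n + 2) * R ^ (n + 1)) := by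
    intro κ
    by_cases hκ : ∃ i, κ i = none
    · exact exists_bound_of_none (C κ) (hC κ) M κ hκ
    · have hκ' : ∀ i, ∃ k, κ i = some k := fun i =>
        Option.ne_none_iff_exists'.1 fun h => hκ ⟨i, h⟩
      choose κ' hκ'' using hκ'
      -- For `n = 0` there are no horizontal differentials, and a term without the contact form
      -- cannot occur.
      rcases n with _ | n
      · exact (κ' 0).elim (fun j => j.elim0) fun j => j.elim0
      · obtain ⟨K, hK0, hK⟩ := exists_bound_of_some (C κ) (hC κ) M κ'
        refine ⟨K, hK0, fun z t δ R h0 h1 hR hV hs => ?_⟩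
        have := hK z t δ R h0 h1 hR hV hs
        simpa only [hκ'', coframeRow] using this
  choose K hK0 hK using key
  refine ⟨∑ κ, K κ, Finset.sum_nonneg fun κ _ => hK0 κ, ?_⟩
  intro z t δ R h0 h1 hR hV hs
  have hs' : ∀ κ x, R ≤ ‖x‖ → C κ (fun k => z k x, t x) = 0 := by
    intro κ x hx
    obtain ⟨i, hi⟩ := hs x hx
    -- A vanishing differential of a single `g i` already kills the coefficient of every term.
    exact Finset.prod_eq_zero (Finset.mem_univ i) (coframeCoeff_eq_zero hi _)
  have hexp : ∀ x, jac (fun i x => g i (fun k => z k x, t x)) x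
      = ∑ κ, C κ (fun k => z k x, t x) *
        Matrix.detRowAlternating fun i => coframeRow z t (κ i) x := by
    intro x
    unfold jac
    simp only [grad_comp_coords hV.contDiff_z hV.contDiff_t (hg _)]
    have h3 := MultilinearMap.map_sum
      (Matrix.detRowAlternating (n := Fin (n + 1)) (R := ℝ)).toMultilinearMap
      (fun i (o : Option (Fin n ⊕ Fin n)) =>
        coframeCoeff (g i) o (fun k => z k x, t x) • coframeRow z t o x)
    refine h3.trans (Finset.sum_congr rfl fun κ _ => ?_)
    exact MultilinearMap.map_smul_univ _ _ _
  have hint : ∀ κ, Integrable fun x => C κ (fun k => z k x, t x) *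
      Matrix.detRowAlternating fun i => coframeRow z t (κ i) x := by
    intro κ
    have hcont : Continuous fun x => C κ (fun k => z k x, t x) :=
      (hC κ).continuous.comp (contDiff_coords hV.contDiff_z hV.contDiff_t).continuous
    refine (hcont.mul (continuous_detRow (continuous_pi fun i =>
      continuous_coframeRow hV.contDiff_z hV.contDiff_t _))).integrable_of_hasCompactSupport
      (HasCompactSupport.mul_right ?_)
    exact HasCompactSupport.intro (isCompact_closedBall (0 : Fin (n + 1) → ℝ) R) fun x hx =>
      hs' κ x (by simpa using (not_le.1 (by simpa using hx)).le)
  simp only [hexp]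
  rw [integral_finsetSum _ fun κ _ => hint κ, Finset.sum_mul]
  exact (Finset.abs_sum_le_sum_abs _ _).trans (Finset.sum_le_sum fun κ _ =>
    hK κ z t δ R h0 h1 hR hV (hs' κ))

end Smallness

/-! ### Mollification of maps into the Heisenberg group -/

section Mollification

/-- A smooth bump function supported in the unit ball. -/
noncomputable def unitBump (N : ℕ) : ContDiffBump (0 : Fin N → ℝ) where
  rIn := 1 / 2
  rOut := 1
  rIn_pos := by norm_num
  rIn_lt_rOut := by norm_num

/-- The normalized smooth kernel of the mollification. -/
noncomputable def mollKernel (N : ℕ) : (Fin N → ℝ) → ℝ := (unitBump N).normed volume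

/-- The mollification of `u` at unit scale. -/
noncomputable def mollify {N : ℕ} (u : (Fin N → ℝ) → ℝ) : (Fin N → ℝ) → ℝ :=
  mollKernel N ⋆[ContinuousLinearMap.lsmul ℝ ℝ, volume] u

variable {N : ℕ}

theorem contDiff_mollKernel : ContDiff ℝ ∞ (mollKernel N) := (unitBump N).contDiff_normed

theorem hasCompactSupport_mollKernel : HasCompactSupport (mollKernel N) :=
  (unitBump N).hasCompactSupport_normed

theorem contDiff_mollify {u : (Fin N → ℝ) → ℝ} (hu : Continuous u) : ContDiff ℝ ∞ (mollify u) :=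
  hasCompactSupport_mollKernel.contDiff_convolution_left _ contDiff_mollKernel
    hu.locallyIntegrable

theorem abs_mollify_sub_le {u : (Fin N → ℝ) → ℝ} (hu : Continuous u) {x : Fin N → ℝ} {ε : ℝ}
    (h : ∀ y, ‖y - x‖ ≤ 1 → |u y - u x| ≤ ε) : |mollify u x - u x| ≤ ε := by
  have := (unitBump N).dist_normed_convolution_le (μ := volume) (g := u) (x₀ := x) (ε := ε)
    hu.aestronglyMeasurable (fun y hy => by
      rw [Real.dist_eq]
      exact h y (by rw [← dist_eq_norm]; exact (Metric.mem_ball.1 hy).le))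
  rwa [Real.dist_eq] at this

theorem mollKernel_eq_zero {y : Fin N → ℝ} (hy : 1 < ‖y‖) : y ∉ tsupport (mollKernel N) := by
  rw [mollKernel, ContDiffBump.tsupport_normed_eq, Metric.mem_closedBall, dist_zero_right]
  exact not_le.2 hy

theorem grad_mollKernel_eq_zero {y : Fin N → ℝ} (hy : 1 < ‖y‖) : grad (mollKernel N) y = 0 :=
  grad_eq_zero_of_notMem_tsupport (mollKernel_eq_zero hy)

theorem hasCompactSupport_grad_mollKernel (l : Fin N) :
    HasCompactSupport fun y => grad (mollKernel N) y l :=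
  HasCompactSupport.intro' hasCompactSupport_mollKernel (isClosed_tsupport _) fun x hx => by
    rw [grad_eq_zero_of_notMem_tsupport hx, Pi.zero_apply]

theorem integrable_grad_mollKernel_mul {v : (Fin N → ℝ) → ℝ} (hv : Continuous v) (l : Fin N) :
    Integrable fun y => grad (mollKernel N) y l * v y :=
  ((contDiff_grad contDiff_mollKernel l).continuous.mul hv).integrable_of_hasCompactSupport
    (hasCompactSupport_grad_mollKernel l).mul_right

theorem grad_mollify {u : (Fin N → ℝ) → ℝ} (hu : Continuous u) (x : Fin N → ℝ) (l : Fin N) :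
    grad (mollify u) x l = ∫ y, grad (mollKernel N) y l * u (x - y) := by
  have h := hasCompactSupport_mollKernel.hasFDerivAt_convolution_left
    (ContinuousLinearMap.lsmul ℝ ℝ) (contDiff_mollKernel.of_le (by simp))
    (hu.locallyIntegrable (μ := volume)) x
  have hi := (hasCompactSupport_mollKernel.fderiv ℝ).convolutionExists_left
    ((ContinuousLinearMap.lsmul ℝ ℝ).precompL (Fin N → ℝ))
    (contDiff_mollKernel.continuous_fderiv (by simp)) (hu.locallyIntegrable (μ := volume)) x
  rw [grad, mollify, h.fderiv, convolution_def, ContinuousLinearMap.integral_apply hi]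
  rfl

theorem integral_grad_mollKernel (l : Fin N) : ∫ y, grad (mollKernel N) y l = 0 := by
  have hi : Integrable (mollKernel N) :=
    contDiff_mollKernel.continuous.integrable_of_hasCompactSupport hasCompactSupport_mollKernel
  have hg : Integrable fun y => grad (mollKernel N) y l * 1 :=
    integrable_grad_mollKernel_mul continuous_const l
  have h := integral_mul_fderiv_eq_neg_fderiv_mul_of_integrable (μ := volume)
    (f := fun _ => (1 : ℝ)) (g := mollKernel N) (v := Pi.single l 1)
    (by simp) (by simpa [grad] using hg) (by simpa using hi) (by simp)
    (fun x _ => contDiff_mollKernel.differentiable (by simp) x)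
  simpa [grad] using h

/-- The operator norm constant of the gradient of the mollification. -/
noncomputable def mollConst (N : ℕ) : ℝ := ∑ l : Fin N, ∫ y, |grad (mollKernel N) y l|

theorem mollConst_nonneg (N : ℕ) : 0 ≤ mollConst N :=
  Finset.sum_nonneg fun _ _ => integral_nonneg fun _ => abs_nonneg _

theorem abs_integral_grad_mollKernel_mul_le {v : (Fin N → ℝ) → ℝ} {ε : ℝ}
    (h : ∀ y, ‖y‖ ≤ 1 → |v y| ≤ ε) (l : Fin N) :
    |∫ y, grad (mollKernel N) y l * v y| ≤ mollConst N * ε := by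
  have hε : 0 ≤ ε := (abs_nonneg _).trans (h 0 (by simp))
  have hi : Integrable fun y => |grad (mollKernel N) y l| := by
    simpa using (integrable_grad_mollKernel_mul (v := fun _ => 1) continuous_const l).abs
  calc |∫ y, grad (mollKernel N) y l * v y| ≤ ∫ y, |grad (mollKernel N) y l| * ε := by
        refine (Real.norm_eq_abs _).symm.le.trans
          (norm_integral_le_of_norm_le (hi.mul_const ε) (Eventually.of_forall fun y => ?_))
        rw [Real.norm_eq_abs, abs_mul]
        by_cases hy : ‖y‖ ≤ 1
        · exact mul_le_mul_of_nonneg_left (h y hy) (abs_nonneg _)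
        · rw [grad_mollKernel_eq_zero (not_le.1 hy)]; simp
    _ = (∫ y, |grad (mollKernel N) y l|) * ε := integral_mul_const _ _
    _ ≤ mollConst N * ε := by
        refine mul_le_mul_of_nonneg_right ?_ hε
        exact Finset.single_le_sum (f := fun l => ∫ y, |grad (mollKernel N) y l|)
          (fun _ _ => integral_nonneg fun _ => abs_nonneg _) (Finset.mem_univ l)

/-- The gradient of the kernel has mean zero, so any constant may be subtracted; the gradient of the
mollification is thus controlled by oscillation alone. -/
theorem grad_mollify_eq_sub_const {u : (Fin N → ℝ) → ℝ} (hu : Continuous u) (c : ℝ)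
    (x : Fin N → ℝ) (l : Fin N) :
    grad (mollify u) x l = ∫ y, grad (mollKernel N) y l * (u (x - y) - c) := by
  have hi := integrable_grad_mollKernel_mul (v := fun y => u (x - y)) (by fun_prop) l
  have hc := integrable_grad_mollKernel_mul (v := fun _ => c) continuous_const l
  rw [grad_mollify hu]
  simp only [mul_sub]
  rw [integral_sub hi hc, integral_mul_const, integral_grad_mollKernel, zero_mul, sub_zero]

variable {n : ℕ}

/-- The oscillation of a map into the Heisenberg group, in coordinates, is at most `δ` at unit
scale. -/
structure HeisenbergOsc (z : Fin n ⊕ Fin n → (Fin N → ℝ) → ℝ) (t : (Fin N → ℝ) → ℝ)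
    (M δ : ℝ) : Prop where
  continuous_z : ∀ k, Continuous (z k)
  continuous_t : Continuous t
  norm_le : ∀ x, ‖((fun k => z k x, t x) : (Fin n ⊕ Fin n → ℝ) × ℝ)‖ ≤ M
  abs_sub_le : ∀ k x y, ‖x - y‖ ≤ 1 → |z k x - z k y| ≤ δ
  abs_vertical_le : ∀ x y, ‖x - y‖ ≤ 1 →
    |t x - t y - ∑ k, dualCoeff (fun k => z k y) k * z k x| ≤ δ ^ 2

/-- The symplectic pairing is alternating. -/
theorem sum_dualCoeff_mul_self (w : Fin n ⊕ Fin n → ℝ) : ∑ k, dualCoeff w k * w k = 0 := by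
  rw [Fintype.sum_sum_type, ← Finset.sum_add_distrib]
  exact Finset.sum_eq_zero fun j _ => by simp only [dualCoeff]; ring

theorem dualCoeff_sub (w w' : Fin n ⊕ Fin n → ℝ) (k : Fin n ⊕ Fin n) :
    dualCoeff (fun k => w k - w' k) k = dualCoeff w k - dualCoeff w' k := by
  rcases k with j | j <;> simp only [dualCoeff] <;> ring

theorem abs_dualCoeff_le {w : Fin n ⊕ Fin n → ℝ} {ε : ℝ} (h : ∀ k, |w k| ≤ ε)
    (k : Fin n ⊕ Fin n) : |dualCoeff w k| ≤ 2 * ε := by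
  rcases k with j | j <;> simp only [dualCoeff, abs_neg, abs_mul, abs_two] <;>
    exact mul_le_mul_of_nonneg_left (h _) (by norm_num)

theorem abs_sum_dualCoeff_mul_le {w w' : Fin n ⊕ Fin n → ℝ} {ε ε' : ℝ} (h : ∀ k, |w k| ≤ ε)
    (h' : ∀ k, |w' k| ≤ ε') : |∑ k, dualCoeff w k * w' k| ≤ 4 * n * (ε * ε') := by
  calc _ ≤ ∑ k : Fin n ⊕ Fin n, |dualCoeff w k * w' k| := Finset.abs_sum_le_sum_abs _ _
    _ ≤ ∑ _k : Fin n ⊕ Fin n, 2 * ε * ε' := by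
        refine Finset.sum_le_sum fun k _ => ?_
        rw [abs_mul]
        exact mul_le_mul (abs_dualCoeff_le h k) (h' k) (abs_nonneg _)
          ((abs_nonneg _).trans (abs_dualCoeff_le h k))
    _ = _ := by
        rw [Finset.sum_const, Finset.card_univ, Fintype.card_sum, Fintype.card_fin, nsmul_eq_mul]
        push_cast
        ring

variable {z : Fin n ⊕ Fin n → (Fin N → ℝ) → ℝ} {t : (Fin N → ℝ) → ℝ} {M δ : ℝ}

theorem HeisenbergOsc.abs_z_le (h : HeisenbergOsc z t M δ) (k : Fin n ⊕ Fin n) (x : Fin N → ℝ) :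
    |z k x| ≤ M :=
  ((norm_le_pi_norm (fun k => z k x) k).trans (le_max_left _ _)).trans (h.norm_le x)

/-- The quadratic bound holds only for the twisted vertical increment. Untwisting costs the pairing
of `z y` with `z x - z y`, which is merely linear in `δ` and carries the factor `M`. -/
theorem HeisenbergOsc.abs_t_sub_le (h : HeisenbergOsc z t M δ) (h0 : 0 ≤ δ) (h1 : δ ≤ 1)
    {x y : Fin N → ℝ} (hxy : ‖x - y‖ ≤ 1) : |t x - t y| ≤ (1 + 4 * n * M) * δ := by
  have e : t x - t y = (t x - t y - ∑ k, dualCoeff (fun k => z k y) k * z k x)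
      + ∑ k, dualCoeff (fun k => z k y) k * (z k x - z k y) := by
    simp only [mul_sub, Finset.sum_sub_distrib, sum_dualCoeff_mul_self]
    ring
  rw [e]
  refine (abs_add_le _ _).trans ?_
  have h2 := h.abs_vertical_le x y hxy
  have h3 := abs_sum_dualCoeff_mul_le (fun k => h.abs_z_le k y) fun k => h.abs_sub_le k x y hxy
  nlinarith

theorem HeisenbergOsc.norm_mollify_sub_le (h : HeisenbergOsc z t M δ) (h0 : 0 ≤ δ) (h1 : δ ≤ 1)
    (x : Fin N → ℝ) :
    ‖((fun k => mollify (z k) x, mollify t x) : (Fin n ⊕ Fin n → ℝ) × ℝ)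
      - (fun k => z k x, t x)‖ ≤ (1 + 4 * n * M) * δ := by
  have hM : 0 ≤ M := (norm_nonneg _).trans (h.norm_le x)
  refine max_le ?_ ?_
  · refine (pi_norm_le_iff_of_nonneg (by positivity)).2 fun k => ?_
    have := abs_mollify_sub_le (h.continuous_z k) fun y hy => h.abs_sub_le k y x hy
    refine le_trans this ?_
    have : 0 ≤ 4 * n * M * δ := by positivity
    linarith
  · exact abs_mollify_sub_le h.continuous_t fun y hy => h.abs_t_sub_le h0 h1 hy

/-- The contact row averages the vertical increment twisted by the mollified coordinates at `x`.
Twisting by the original coordinates instead gives the Heisenberg increment, which is `O(δ ^ 2)`;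
the difference pairs the mollification error with an increment of `z`, a product of two factors of
size `δ`. No first order term remains. -/
theorem HeisenbergOsc.almostHorizontal (h : HeisenbergOsc z t M δ) (h0 : 0 ≤ δ) (h1 : δ ≤ 1) :
    AlmostHorizontal (fun k => mollify (z k)) (mollify t) (M + (1 + 4 * n * M))
      ((1 + mollConst N) * (1 + 4 * n) * δ) := by
  have hK := mollConst_nonneg N
  have hM : 0 ≤ M := (norm_nonneg _).trans (h.norm_le 0)
  refine ⟨fun k => contDiff_mollify (h.continuous_z k), contDiff_mollify h.continuous_t,
    fun x => ?_, fun k x l => ?_, fun x l => ?_⟩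
  · have h2 := h.norm_mollify_sub_le h0 h1 x
    have h3 := norm_le_norm_add_norm_sub' ((fun k => mollify (z k) x, mollify t x) :
      (Fin n ⊕ Fin n → ℝ) × ℝ) (fun k => z k x, t x)
    have h4 := h.norm_le x
    have h5 : (1 + 4 * n * M) * δ ≤ 1 + 4 * n * M := mul_le_of_le_one_right (by positivity) h1
    linarith
  · rw [grad_mollify_eq_sub_const (h.continuous_z k) (z k x)]
    refine (abs_integral_grad_mollKernel_mul_le (ε := δ)
      (fun y hy => h.abs_sub_le k (x - y) x (by simpa using hy)) l).trans ?_
    refine mul_le_mul_of_nonneg_right ?_ h0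
    have : (0 : ℝ) ≤ 4 * n * (1 + mollConst N) := by positivity
    nlinarith
  · set w : Fin n ⊕ Fin n → ℝ := fun k => mollify (z k) x with hw
    have e1 : contactRow (fun k => mollify (z k)) (mollify t) x l
        = ∫ y, grad (mollKernel N) y l *
          ((t (x - y) - t x) - ∑ k, dualCoeff w k * (z k (x - y) - z k x)) := by
      have hcz : ∀ k, Continuous fun y => z k (x - y) - z k x := fun k =>
        ((h.continuous_z k).comp (continuous_const.sub continuous_id)).sub continuous_const
      have hct : Continuous fun y => t (x - y) - t x :=
        (h.continuous_t.comp (continuous_const.sub continuous_id)).sub continuous_const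
      have hi : ∀ k, Integrable fun y =>
          grad (mollKernel N) y l * (dualCoeff w k * (z k (x - y) - z k x)) := fun k =>
        integrable_grad_mollKernel_mul (continuous_const.mul (hcz k)) l
      simp only [mul_sub (grad (mollKernel N) _ l) (t _ - t x), Finset.mul_sum]
      rw [integral_sub (integrable_grad_mollKernel_mul hct l) (integrable_finsetSum _ fun k _ => hi k),
        integral_finsetSum _ fun k _ => hi k, contactRow, Pi.sub_apply, Finset.sum_apply,
        grad_mollify_eq_sub_const h.continuous_t (t x)]
      congr 1
      refine Finset.sum_congr rfl fun k _ => ?_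
      rw [Pi.smul_apply, smul_eq_mul, grad_mollify_eq_sub_const (h.continuous_z k) (z k x),
        ← integral_const_mul]
      congr 1
      funext y
      ring
    have e2 : ∀ y, (t (x - y) - t x) - ∑ k, dualCoeff w k * (z k (x - y) - z k x)
        = (t (x - y) - t x - ∑ k, dualCoeff (fun k => z k x) k * z k (x - y))
          - ∑ k, dualCoeff (fun k => w k - z k x) k * (z k (x - y) - z k x) := by
      intro y
      have e3 := sum_dualCoeff_mul_self fun k => z k x
      simp only [dualCoeff_sub w fun k => z k x, sub_mul, mul_sub, Finset.sum_sub_distrib, e3]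
      ring
    rw [e1]
    refine (abs_integral_grad_mollKernel_mul_le (ε := (1 + 4 * n) * δ ^ 2) (fun y hy => ?_) l).trans
      ?_
    · rw [e2]
      have hxy : ‖x - y - x‖ ≤ 1 := by simpa using hy
      refine (abs_sub _ _).trans ?_
      have h2 := h.abs_vertical_le (x - y) x hxy
      have h3 := abs_sum_dualCoeff_mul_le (w := fun k => w k - z k x)
        (fun k => abs_mollify_sub_le (h.continuous_z k) fun y hy => h.abs_sub_le k y x hy)
        fun k => h.abs_sub_le k (x - y) x hxy
      linarith
    · rw [mul_pow, mul_pow, ← mul_assoc]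
      refine mul_le_mul_of_nonneg_right ?_ (sq_nonneg _)
      -- The constant enters the contact bound squared; adding 1 to each factor lets a single
      -- constant serve both estimates.
      have a1 : mollConst N ≤ (1 + mollConst N) ^ 2 := by nlinarith
      have a2 : (1 + 4 * n : ℝ) ≤ (1 + 4 * n) ^ 2 := by
        have : (0 : ℝ) ≤ 4 * n := by positivity
        nlinarith
      exact mul_le_mul a1 a2 (by positivity) (by positivity)

end Mollification

/-! ### Degree one via smooth steps -/

section Degree

/-- A smooth step function, equal to `0` below `-1/2` and to `1` above `1/2`. -/
noncomputable def smoothStep (s : ℝ) : ℝ := Real.smoothTransition (s + 1 / 2)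

theorem contDiff_smoothStep : ContDiff ℝ ∞ smoothStep :=
  Real.smoothTransition.contDiff.comp (contDiff_id.add contDiff_const)

theorem deriv_smoothStep_eq_zero {s : ℝ} (hs : 1 / 2 < |s|) : deriv smoothStep s = 0 := by
  rcases lt_abs.1 hs with h | h
  · have : smoothStep =ᶠ[𝓝 s] fun _ => 1 := by
      filter_upwards [lt_mem_nhds h] with y hy
      exact Real.smoothTransition.one_of_one_le (by linarith)
    rw [this.deriv_eq, deriv_const]
  · have : smoothStep =ᶠ[𝓝 s] fun _ => 0 := by
      filter_upwards [gt_mem_nhds (show s < -(1 / 2) by linarith)] with y hy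
      exact Real.smoothTransition.zero_of_nonpos (by linarith)
    rw [this.deriv_eq, deriv_const]

/-- Outside the slab `|P| ≤ 1 / 2` the step is locally constant. This localises both the degree and
the smallness estimates. -/
theorem fderiv_smoothStep_comp_eq_zero {E : Type*} [NormedAddCommGroup E] [NormedSpace ℝ E]
    {P : E → ℝ} {v : E} (hP : DifferentiableAt ℝ P v) (h : 1 / 2 < |P v|) :
    fderiv ℝ (fun w => smoothStep (P w)) v = 0 := by
  have h1 := ((contDiff_smoothStep.differentiable (by simp) _).hasDerivAt.comp_hasFDerivAt v
    hP.hasFDerivAt).fderiv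
  rw [deriv_smoothStep_eq_zero h, zero_smul] at h1
  exact h1

theorem integrable_deriv_smoothStep : Integrable (deriv smoothStep) :=
  (contDiff_smoothStep.continuous_deriv (by simp)).integrable_of_hasCompactSupport
    (HasCompactSupport.intro (isCompact_closedBall (0 : ℝ) (1 / 2)) fun s hs =>
      deriv_smoothStep_eq_zero (by simpa using hs))

theorem integral_deriv_smoothStep : ∫ s, deriv smoothStep s = 1 := by
  have h := integral_of_hasDerivAt_of_tendsto (f := smoothStep) (m := 0) (n := 1)
    (fun s => (contDiff_smoothStep.differentiable (by simp) s).hasDerivAt)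
    integrable_deriv_smoothStep
    (tendsto_const_nhds.congr' (by
      filter_upwards [eventually_le_atBot (-1)] with s hs
      exact (Real.smoothTransition.zero_of_nonpos (by linarith)).symm))
    (tendsto_const_nhds.congr' (by
      filter_upwards [eventually_ge_atTop 1] with s hs
      exact (Real.smoothTransition.one_of_one_le (by linarith)).symm))
  simpa using h

variable {ι : Type*} [Fintype ι] [DecidableEq ι]

theorem grad_smoothStep_comp {u : (ι → ℝ) → ℝ} (hu : ContDiff ℝ ∞ u) (x : ι → ℝ) :
    grad (fun y => smoothStep (u y)) x = deriv smoothStep (u x) • grad u x := by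
  ext l
  have h := ((contDiff_smoothStep.differentiable (by simp) (u x)).hasDerivAt.comp_hasFDerivAt x
    (hu.differentiable (by simp) x).hasFDerivAt).fderiv
  simp only [Function.comp_def] at h
  simp [grad, h]

theorem grad_smoothStep_comp_eq_zero {u : (ι → ℝ) → ℝ} (hu : ContDiff ℝ ∞ u) {x : ι → ℝ}
    (h : 1 / 2 < |u x|) : grad (fun y => smoothStep (u y)) x = 0 := by
  rw [grad_smoothStep_comp hu, deriv_smoothStep_eq_zero h, zero_smul]

theorem jac_smoothStep_coords (x : ι → ℝ) :
    jac (fun i y => smoothStep (y i)) x = ∏ i, deriv smoothStep (x i) := by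
  have h : (fun i => grad (fun y : ι → ℝ => smoothStep (y i)) x)
      = Matrix.diagonal fun i => deriv smoothStep (x i) := by
    funext i l
    rw [grad_smoothStep_comp (u := fun y => y i) (contDiff_apply ℝ ℝ i)]
    have h2 : fderiv ℝ (fun y : ι → ℝ => y i) x = ContinuousLinearMap.proj i :=
      (ContinuousLinearMap.proj (R := ℝ) (φ := fun _ : ι => ℝ) i).fderiv
    simp [grad, h2, Matrix.diagonal_apply, Pi.single_apply]
  rw [jac, h]
  exact Matrix.det_diagonal

/-- A smooth map that points into the same half spaces as the identity away from a ball has degree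
one. -/
theorem integral_jac_smoothStep_eq_one {h : ι → (ι → ℝ) → ℝ} (hh : ∀ i, ContDiff ℝ ∞ (h i))
    {R : ℝ} (hR : 0 ≤ R)
    (hs : ∀ x, R ≤ ‖x‖ →
      ∃ i, (1 / 2 < h i x ∧ 1 / 2 < x i) ∨ (h i x < -(1 / 2) ∧ x i < -(1 / 2))) :
    ∫ x, jac (fun i y => smoothStep (h i y)) x = 1 := by
  -- The inner radius is `R + 1` because it must be positive even for `R = 0`.
  let χ : ContDiffBump (0 : ι → ℝ) := ⟨R + 1, R + 2, by linarith, by linarith⟩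
  have hχ : ContDiff ℝ ∞ χ := χ.contDiff
  -- This interpolates from `h` to the identity. Where the cutoff is not locally 1, `h i` and `x i`
  -- lie in the same half line for some `i`, hence so does their convex combination, and both
  -- Jacobians vanish.
  set k : ι → (ι → ℝ) → ℝ := fun i x => χ x * h i x + (1 - χ x) * x i with hk
  have hkd : ∀ i, ContDiff ℝ ∞ (k i) := fun i =>
    (hχ.mul (hh i)).add ((contDiff_const.sub hχ).mul (contDiff_apply ℝ ℝ i))
  have e1 : ∀ x, jac (fun i y => smoothStep (h i y)) x = jac (fun i y => smoothStep (k i y)) x := by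
    intro x
    by_cases hx : ‖x‖ < R + 1
    · unfold jac
      congr 1
      funext i
      have : (fun y => smoothStep (h i y)) =ᶠ[𝓝 x] fun y => smoothStep (k i y) := by
        filter_upwards [continuous_norm.continuousAt.eventually (gt_mem_nhds hx)] with y hy
        have : χ y = 1 := χ.one_of_mem_closedBall (by simpa using le_of_lt hy)
        simp [hk, this]
      funext l
      simp only [grad, this.fderiv_eq]
    · obtain ⟨i, hi⟩ := hs x (by linarith)
      have c0 : 0 ≤ χ x := χ.nonneg
      have c1 : χ x ≤ 1 := χ.le_one
      have a1 : 1 / 2 < |h i x| := by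
        rcases hi with hi | hi
        · exact lt_abs.2 (Or.inl hi.1)
        · exact lt_abs.2 (Or.inr (by linarith [hi.1]))
      have a2 : 1 / 2 < |k i x| := by
        rcases hi with ⟨h1, h2⟩ | ⟨h1, h2⟩
        · refine lt_abs.2 (Or.inl ?_)
          simp only [hk]
          rcases eq_or_lt_of_le c0 with h0 | h0
          · rw [← h0]; linarith
          · nlinarith [mul_lt_mul_of_pos_left h1 h0]
        · refine lt_abs.2 (Or.inr ?_)
          simp only [hk]
          rcases eq_or_lt_of_le c0 with h0 | h0
          · rw [← h0]; linarith
          · nlinarith [mul_lt_mul_of_pos_left h1 h0]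
      have b1 : jac (fun i y => smoothStep (h i y)) x = 0 :=
        AlternatingMap.map_coord_zero _ i (grad_smoothStep_comp_eq_zero (hh i) a1)
      have b2 : jac (fun i y => smoothStep (k i y)) x = 0 :=
        AlternatingMap.map_coord_zero _ i (grad_smoothStep_comp_eq_zero (hkd i) a2)
      rw [b1, b2]
  simp only [e1]
  have hint : Integrable (jac fun i (y : ι → ℝ) => smoothStep (y i)) := by
    have : Integrable fun x : ι → ℝ => ∏ i, deriv smoothStep (x i) :=
      Integrable.fintype_prod fun _ => integrable_deriv_smoothStep
    exact this.congr (Eventually.of_forall fun x => (jac_smoothStep_coords x).symm)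
  rw [integral_jac_eq_of_hasCompactSupport_sub (u := fun i y => smoothStep (k i y))
    (v := fun i y => smoothStep (y i))
    (fun i => contDiff_smoothStep.comp (hkd i))
    (fun i => contDiff_smoothStep.comp (contDiff_apply ℝ ℝ i)) (fun i => ?_) hint]
  · simp only [jac_smoothStep_coords]
    rw [integral_fintype_prod_volume_eq_prod fun (_ : ι) => deriv smoothStep]
    simp [integral_deriv_smoothStep]
  · refine HasCompactSupport.intro (isCompact_closedBall (0 : ι → ℝ) (R + 2)) fun x hx => ?_
    have : χ x = 0 := χ.zero_of_le_dist (by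
      have : R + 2 < ‖x‖ := by simpa using hx
      simpa using this.le)
    simp [hk, this]

end Degree

/-! ### Approximate inverse on the sphere -/

/-- Stone–Weierstrass for compositions: a continuous function on a compact space is a uniform limit
of smooth functions of any continuous injective map into a space of coordinates. -/
theorem exists_contDiff_comp_near {S E ι : Type*} [TopologicalSpace S] [CompactSpace S]
    [NormedAddCommGroup E] [NormedSpace ℝ E] {F : S → E} (hF : Continuous F)
    (hinj : Function.Injective F) (c : ι → E →L[ℝ] ℝ) (hc : ∀ v w : E, (∀ i, c i v = c i w) → v = w)
    {τ : S → ℝ} (hτ : Continuous τ) {ε : ℝ} (hε : 0 < ε) :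
    ∃ P : E → ℝ, ContDiff ℝ ∞ P ∧ ∀ s, |P (F s) - τ s| < ε := by
  let A : Subalgebra ℝ C(S, ℝ) := Algebra.adjoin ℝ
    (Set.range fun i => (⟨fun s => c i (F s), (c i).continuous.comp hF⟩ : C(S, ℝ)))
  have hsep : A.SeparatesPoints := by
    intro s s' hss
    have : ∃ i, c i (F s) ≠ c i (F s') := by
      by_contra! h
      exact hss (hinj (hc _ _ h))
    obtain ⟨i, hi⟩ := this
    exact ⟨_, ⟨_, Algebra.subset_adjoin ⟨i, rfl⟩, rfl⟩, hi⟩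
  obtain ⟨⟨g, hgA⟩, hg⟩ :=
    ContinuousMap.exists_mem_subalgebra_near_continuous_of_separatesPoints A hsep τ hτ ε hε
  -- Elements of the generated algebra are polynomials in the coordinates, so they extend smoothly
  -- to all of `E`.
  have key : ∃ P : E → ℝ, ContDiff ℝ ∞ P ∧ ∀ s, P (F s) = g s := by
    refine Algebra.adjoin_induction (p := fun g _ => ∃ P : E → ℝ, ContDiff ℝ ∞ P ∧
      ∀ s, P (F s) = g s) ?_ ?_ ?_ ?_ hgA
    · rintro _ ⟨i, rfl⟩
      exact ⟨c i, (c i).contDiff, fun _ => rfl⟩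
    · intro r
      exact ⟨fun _ => r, contDiff_const, fun _ => rfl⟩
    · rintro _ _ _ _ ⟨P, hP, hPg⟩ ⟨Q, hQ, hQg⟩
      exact ⟨fun v => P v + Q v, hP.add hQ, fun s => by simp [hPg, hQg]⟩
    · rintro _ _ _ _ ⟨P, hP, hPg⟩ ⟨Q, hQ, hQg⟩
      exact ⟨fun v => P v * Q v, hP.mul hQ, fun s => by simp [hPg, hQg]⟩
  obtain ⟨P, hP, hPg⟩ := key
  exact ⟨P, hP, fun s => by rw [hPg]; exact hg s⟩

/-! ### The radial retraction -/

section Retraction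

variable {E : Type*} [NormedAddCommGroup E] [NormedSpace ℝ E]

/-- The radial retraction onto the closed unit ball. -/
noncomputable def radialRetraction (x : E) : E := (max 1 ‖x‖)⁻¹ • x

theorem norm_radialRetraction_le (x : E) : ‖radialRetraction x‖ ≤ 1 := by
  have h : 0 < max 1 ‖x‖ := lt_max_of_lt_left one_pos
  rw [radialRetraction, norm_smul, norm_inv, Real.norm_of_nonneg h.le, inv_mul_le_iff₀ h, mul_one]
  exact le_max_right _ _

/-- The difference splits into `a⁻¹ • (x - y)` and a multiple of `y` coming from the change of
scale, each of norm at most `‖x - y‖`. -/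
theorem norm_radialRetraction_sub_le (x y : E) :
    ‖radialRetraction x - radialRetraction y‖ ≤ 2 * ‖x - y‖ := by
  set a := max 1 ‖x‖ with ha
  set b := max 1 ‖y‖ with hb
  have ha1 : 1 ≤ a := le_max_left _ _
  have hb1 : 1 ≤ b := le_max_left _ _
  have hab : |b - a| ≤ ‖x - y‖ := by
    rw [ha, hb, max_comm 1, max_comm 1, norm_sub_rev]
    exact (abs_max_sub_max_le_abs _ _ _).trans (abs_norm_sub_norm_le y x)
  have e : radialRetraction x - radialRetraction y = a⁻¹ • (x - y) + ((b - a) * (a⁻¹ * b⁻¹)) • y := by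
    have : (b - a) * (a⁻¹ * b⁻¹) = a⁻¹ - b⁻¹ := by field_simp
    rw [this, radialRetraction, radialRetraction, ← ha, ← hb]
    module
  have h1 : ‖a⁻¹ • (x - y)‖ ≤ ‖x - y‖ := by
    rw [norm_smul, norm_inv, Real.norm_of_nonneg (by linarith)]
    exact mul_le_of_le_one_left (norm_nonneg _) (inv_le_one_of_one_le₀ ha1)
  have h2 : ‖((b - a) * (a⁻¹ * b⁻¹)) • y‖ ≤ ‖x - y‖ := by
    have h3 : a⁻¹ * (b⁻¹ * ‖y‖) ≤ 1 := by
      refine mul_le_one₀ (inv_le_one_of_one_le₀ ha1) (by positivity) ?_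
      rw [inv_mul_le_iff₀ (by linarith), mul_one]
      exact le_max_right _ _
    rw [norm_smul, norm_mul, Real.norm_eq_abs, Real.norm_of_nonneg (by positivity), mul_assoc,
      mul_assoc]
    calc |b - a| * (a⁻¹ * (b⁻¹ * ‖y‖)) ≤ ‖x - y‖ * 1 :=
          mul_le_mul hab h3 (by positivity) (norm_nonneg _)
      _ = _ := mul_one _
  rw [e]
  exact (norm_add_le _ _).trans (by linarith)

theorem continuous_radialRetraction : Continuous (radialRetraction : E → E) :=
  (LipschitzWith.of_dist_le_mul (K := 2) fun x y => by
    rw [dist_eq_norm, dist_eq_norm]; exact norm_radialRetraction_sub_le x y).continuous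

end Retraction

/-! ### Coordinates and the Korányi distance -/

section Coordinates

variable {n : ℕ}

/-- The coordinates of a point of the Heisenberg group, as a point of a normed space. -/
def heisenbergCoords (p : HeisenbergGroup n) : (Fin n ⊕ Fin n → ℝ) × ℝ := (Sum.elim p.x p.y, p.t)

theorem heisenbergCoords_injective :
    Function.Injective (heisenbergCoords : HeisenbergGroup n → _) := by
  intro p q h
  have h1 : Sum.elim p.x p.y = Sum.elim q.x q.y := congrArg Prod.fst h
  ext j
  · exact congrFun h1 (.inl j)
  · exact congrFun h1 (.inr j)
  · exact congrArg Prod.snd h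

theorem abs_heisenbergCoords_sub_le (p q : HeisenbergGroup n) (k : Fin n ⊕ Fin n) :
    |(heisenbergCoords p).1 k - (heisenbergCoords q).1 k| ≤ dist p q := by
  refine abs_le_of_sq_le_sq ?_ dist_nonneg
  refine le_trans ?_ (HeisenbergGroup.horizSq_le (q⁻¹ * p))
  rcases k with j | j
  · refine le_trans ?_ (Finset.single_le_sum (fun i _ => by positivity) (Finset.mem_univ j))
    simp only [heisenbergCoords, Sum.elim_inl, HeisenbergGroup.mul_x, HeisenbergGroup.inv_x,
      Pi.add_apply, Pi.neg_apply]
    nlinarith [sq_nonneg ((q⁻¹ * p).y j)]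
  · refine le_trans ?_ (Finset.single_le_sum (fun i _ => by positivity) (Finset.mem_univ j))
    simp only [heisenbergCoords, Sum.elim_inr, HeisenbergGroup.mul_y, HeisenbergGroup.inv_y,
      Pi.add_apply, Pi.neg_apply]
    nlinarith [sq_nonneg ((q⁻¹ * p).x j)]

/-- The expression is exactly the vertical coordinate of `q⁻¹ * p`, the imaginary part of a complex
number of modulus `dist p q ^ 2`. -/
theorem abs_heisenbergCoords_vertical_le (p q : HeisenbergGroup n) :
    |(heisenbergCoords p).2 - (heisenbergCoords q).2
      - ∑ k, dualCoeff (heisenbergCoords q).1 k * (heisenbergCoords p).1 k| ≤ dist p q ^ 2 := by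
  have h1 : dist p q ^ 2 = ‖(⟨(q⁻¹ * p).horizSq, (q⁻¹ * p).t⟩ : ℂ)‖ :=
    HeisenbergGroup.koranyiNorm_sq _
  have h2 := Complex.abs_im_le_norm (⟨(q⁻¹ * p).horizSq, (q⁻¹ * p).t⟩ : ℂ)
  rw [h1]
  refine le_trans (le_of_eq ?_) h2
  congr 1
  simp only [heisenbergCoords, Fintype.sum_sum_type, dualCoeff, Sum.elim_inl, Sum.elim_inr,
    HeisenbergGroup.mul_t, HeisenbergGroup.inv_t, HeisenbergGroup.inv_x, HeisenbergGroup.inv_y,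
    Pi.neg_apply, Finset.mul_sum]
  rw [← Finset.sum_add_distrib, sub_eq_add_neg, ← Finset.sum_neg_distrib, sub_eq_add_neg,
    add_comm p.t]
  congr 1
  exact Finset.sum_congr rfl fun j _ => by ring

/-- Horizontal coordinates are 1-Lipschitz. For the vertical one, the increment twisted at the base
point is at most the squared distance, and the twist is continuous and vanishes there. -/
theorem continuous_heisenbergCoords : Continuous (heisenbergCoords : HeisenbergGroup n → _) := by
  have h1 : ∀ k, Continuous fun p : HeisenbergGroup n => (heisenbergCoords p).1 k := fun k =>
    (LipschitzWith.of_dist_le_mul (K := 1) fun p q => by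
      simpa [Real.dist_eq] using abs_heisenbergCoords_sub_le p q k).continuous
  refine (continuous_pi h1).prodMk (continuous_iff_continuousAt.2 fun q => ?_)
  have h2 : Tendsto (fun p : HeisenbergGroup n => (heisenbergCoords p).2 - (heisenbergCoords q).2
      - ∑ k, dualCoeff (heisenbergCoords q).1 k * (heisenbergCoords p).1 k) (𝓝 q) (𝓝 0) := by
    refine squeeze_zero_norm (fun p => abs_heisenbergCoords_vertical_le p q) ?_
    have : Continuous fun p : HeisenbergGroup n => dist p q ^ 2 := by fun_prop
    simpa using this.tendsto q
  have h3 : Tendsto (fun p : HeisenbergGroup n => (heisenbergCoords q).2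
      + ∑ k, dualCoeff (heisenbergCoords q).1 k * (heisenbergCoords p).1 k) (𝓝 q)
      (𝓝 (heisenbergCoords q).2) := by
    have : Continuous fun p : HeisenbergGroup n => (heisenbergCoords q).2
      + ∑ k, dualCoeff (heisenbergCoords q).1 k * (heisenbergCoords p).1 k :=
      continuous_const.add (continuous_finsetSum _ fun k _ => continuous_const.mul (h1 k))
    have h := this.tendsto q
    rwa [sum_dualCoeff_mul_self, add_zero] at h
  have h4 := h2.add h3
  rw [zero_add] at h4
  refine h4.congr fun p => ?_
  simp only [heisenbergCoords]
  ring

end Coordinates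

/-! ### Hölder estimates and auxiliary facts -/

theorem HolderPlusOn.exists_dist_le {X Y : Type*} [MetricSpace X] [MetricSpace Y] {α : ℝ}
    {f : X → Y} {s : Set X} (hf : HolderPlusOn α f s) {ε : ℝ} (hε : 0 < ε) :
    ∃ r > 0, ∀ x ∈ s, ∀ y ∈ s, dist x y ≤ r → dist (f x) (f y) ≤ ε * dist x y ^ α := by
  have h1 : ∀ᶠ t : ℝ in 𝓝[>] 0, _ := hf.eventually (gt_mem_nhds (ENNReal.ofReal_pos.2 hε))
  obtain ⟨r, hr, hr0⟩ := (h1.and self_mem_nhdsWithin).exists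
  refine ⟨r, hr0, fun x hx y hy hxy => ?_⟩
  rcases eq_or_lt_of_le (dist_nonneg (x := x) (y := y)) with h0 | h0
  · rw [dist_eq_zero.1 h0.symm, dist_self]
    positivity
  · have h2 : ENNReal.ofReal (dist (f x) (f y) / dist x y ^ α) < ENNReal.ofReal ε := by
      refine lt_of_le_of_lt ?_ hr
      exact le_iSup₂_of_le x hx (le_iSup₂_of_le y hy (le_iSup_of_le ⟨h0, hxy⟩ le_rfl))
    have h3 := (ENNReal.ofReal_lt_ofReal_iff hε).1 h2
    exact ((div_lt_iff₀ (Real.rpow_pos_of_pos h0 α)).1 h3).le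

theorem continuousOn_of_holder {X Y : Type*} [MetricSpace X] [MetricSpace Y] {α r : ℝ}
    {f : X → Y} {s : Set X} (hα : 0 < α) (hr : 0 < r)
    (hf : ∀ x ∈ s, ∀ y ∈ s, dist x y ≤ r → dist (f x) (f y) ≤ 1 * dist x y ^ α) :
    ContinuousOn f s := by
  intro x hx
  refine tendsto_iff_dist_tendsto_zero.2 ?_
  have h1 : Tendsto (fun y => dist y x ^ α) (𝓝[s] x) (𝓝 0) := by
    have : Continuous fun y => dist y x ^ α :=
      (continuous_id.dist continuous_const).rpow_const fun _ => Or.inr hα.le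
    have h := this.tendsto x
    rw [dist_self, Real.zero_rpow hα.ne'] at h
    exact h.mono_left nhdsWithin_le_nhds
  refine squeeze_zero' (Eventually.of_forall fun _ => dist_nonneg) ?_ h1
  filter_upwards [self_mem_nhdsWithin, nhdsWithin_le_nhds (Metric.closedBall_mem_nhds x hr)]
    with y hy hyx
  simpa using hf y hy x hx (Metric.mem_closedBall.1 hyx)

/-- If every coordinate were below `1 / (n + 1)`, the squares would sum to less than 1. The factor
`n + 1` lets some scaled coordinate survive two errors of `1 / 4` and still leave the slab of the
smooth step. -/
theorem exists_one_le_mul_abs_of_norm_eq_one {n : ℕ} {s : EuclideanSpace ℝ (Fin (n + 1))}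
    (hs : ‖s‖ = 1) : ∃ i, 1 ≤ |((n : ℝ) + 1) * s i| := by
  by_contra! h
  have h1 : ∑ i, s i ^ 2 = 1 := by
    have := EuclideanSpace.norm_sq_eq s
    rw [hs] at this
    simpa using this.symm
  have hn : (0 : ℝ) < n + 1 := by positivity
  have h2 : ∑ i, s i ^ 2 < ∑ _i : Fin (n + 1), 1 / ((n : ℝ) + 1) := by
    refine Finset.sum_lt_sum_of_nonempty Finset.univ_nonempty fun i _ => ?_
    have h3 := h i
    rw [abs_mul, abs_of_pos hn] at h3
    have h4 : |s i| < 1 / ((n : ℝ) + 1) := by rw [lt_div_iff₀ hn]; linarith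
    have h5 : (1 : ℝ) / (n + 1) ≤ 1 := by
      rw [div_le_one hn]
      have : (0 : ℝ) ≤ n := by positivity
      linarith
    rw [← sq_abs]
    nlinarith [abs_nonneg (s i)]
  rw [h1, Finset.sum_const, Finset.card_univ, Fintype.card_fin, nsmul_eq_mul] at h2
  push_cast at h2
  rw [mul_one_div_cancel hn.ne'] at h2
  exact lt_irrefl _ h2

theorem exists_uniform_delta {E : Type*} [NormedAddCommGroup E] [ProperSpace E] {N : ℕ}
    {P : Fin N → E → ℝ} (hP : ∀ i, Continuous (P i)) (M : ℝ) {ε : ℝ} (hε : 0 < ε) :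
    ∃ ρ > 0, ∀ i v w, ‖v‖ ≤ M → ‖w‖ ≤ M → ‖v - w‖ < ρ → |P i v - P i w| < ε := by
  have h := (isCompact_closedBall (0 : E) M).uniformContinuousOn_of_continuous
    (continuous_pi hP).continuousOn
  obtain ⟨ρ, hρ, h⟩ := Metric.uniformContinuousOn_iff.1 h ε hε
  refine ⟨ρ, hρ, fun i v w hv hw hvw => ?_⟩
  have := h v (by simpa using hv) w (by simpa using hw) (by rwa [dist_eq_norm])
  exact lt_of_le_of_lt (dist_le_pi_dist (fun i => P i v) (fun i => P i w) i) this

theorem exists_linearIsometry_euclideanSpace {k m : ℕ} (h : k ≤ m) :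
    Nonempty (EuclideanSpace ℝ (Fin k) →ₗᵢ[ℝ] EuclideanSpace ℝ (Fin m)) := by
  have ho : Orthonormal ℝ ((EuclideanSpace.basisFun (Fin m) ℝ) ∘ Fin.castLE h) :=
    (EuclideanSpace.basisFun (Fin m) ℝ).orthonormal.comp _ (Fin.castLE_injective h)
  let b := (EuclideanSpace.basisFun (Fin k) ℝ).toBasis
  refine ⟨(b.constr ℝ ((EuclideanSpace.basisFun (Fin m) ℝ) ∘ Fin.castLE h)).isometryOfOrthonormal
    (v := b) (by simp [b, (EuclideanSpace.basisFun (Fin k) ℝ).orthonormal]) ?_⟩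
  have : (b.constr ℝ ((EuclideanSpace.basisFun (Fin m) ℝ) ∘ Fin.castLE h)) ∘ b
      = (EuclideanSpace.basisFun (Fin m) ℝ) ∘ Fin.castLE h := by
    funext i
    exact b.constr_basis ℝ _ i
  rw [this]
  exact ho

/-! ### The dilated extension and the contradiction -/

section Extension

variable {n : ℕ}

/-- The radial extension of a map on the unit ball, precomposed with a dilation by `R⁻¹`. -/
noncomputable def dilatedExtension (f : EuclideanSpace ℝ (Fin (n + 1)) → HeisenbergGroup n) (R : ℝ)
    (x : Fin (n + 1) → ℝ) : HeisenbergGroup n :=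
  f (radialRetraction (WithLp.toLp 2 (R⁻¹ • x)))

theorem exists_norm_toLp_le (N : ℕ) :
    ∃ L : ℝ, 0 < L ∧ ∀ x : Fin N → ℝ, ‖(WithLp.toLp 2 x : EuclideanSpace ℝ (Fin N))‖ ≤ L * ‖x‖ := by
  set e := ((EuclideanSpace.equiv (Fin N) ℝ).symm : (Fin N → ℝ) →L[ℝ] EuclideanSpace ℝ (Fin N))
  refine ⟨‖e‖ + 1, by positivity, fun x => ?_⟩
  exact (e.le_opNorm x).trans (mul_le_mul_of_nonneg_right (by linarith) (norm_nonneg _))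

theorem norm_le_norm_toLp {N : ℕ} (x : Fin N → ℝ) :
    ‖x‖ ≤ ‖(WithLp.toLp 2 x : EuclideanSpace ℝ (Fin N))‖ :=
  (pi_norm_le_iff_of_nonneg (norm_nonneg _)).2 fun i =>
    PiLp.norm_apply_le (WithLp.toLp 2 x : EuclideanSpace ℝ (Fin N)) i

theorem continuous_dilatedExtension {f : EuclideanSpace ℝ (Fin (n + 1)) → HeisenbergGroup n}
    (hf : ContinuousOn f (Metric.closedBall 0 1)) (R : ℝ) : Continuous (dilatedExtension f R) := by
  refine hf.comp_continuous (continuous_radialRetraction.comp ?_) fun x => ?_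
  · exact (PiLp.continuous_toLp 2 _).comp (continuous_const_smul _)
  · simpa using norm_radialRetraction_le _

/-- Unit scale after dilation is scale `1 / R` before it. The factor 2 is the Lipschitz constant of
the retraction, and `L` compares the Euclidean norm with the sup norm. -/
theorem heisenbergOsc_dilatedExtension {f : EuclideanSpace ℝ (Fin (n + 1)) → HeisenbergGroup n}
    {α M r ε L R : ℝ} (hα : 0 < α) (hε : 0 ≤ ε) (hL : 0 < L) (hR : 0 < R)
    (hfc : ContinuousOn f (Metric.closedBall 0 1))
    (hM : ∀ x ∈ Metric.closedBall (0 : EuclideanSpace ℝ (Fin (n + 1))) 1,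
      ‖heisenbergCoords (f x)‖ ≤ M)
    (hLn : ∀ x : Fin (n + 1) → ℝ,
      ‖(WithLp.toLp 2 x : EuclideanSpace ℝ (Fin (n + 1)))‖ ≤ L * ‖x‖)
    (hf : ∀ x ∈ Metric.closedBall (0 : EuclideanSpace ℝ (Fin (n + 1))) 1,
      ∀ y ∈ Metric.closedBall (0 : EuclideanSpace ℝ (Fin (n + 1))) 1,
        dist x y ≤ r → dist (f x) (f y) ≤ ε * dist x y ^ α)
    (hRr : 2 * L / R ≤ r) :
    HeisenbergOsc (fun k x => (heisenbergCoords (dilatedExtension f R x)).1 k)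
      (fun x => (heisenbergCoords (dilatedExtension f R x)).2) M (ε * (2 * L / R) ^ α) := by
  have hc := continuous_heisenbergCoords.comp (continuous_dilatedExtension hfc R)
  have hmem : ∀ x : EuclideanSpace ℝ (Fin (n + 1)),
      radialRetraction x ∈ Metric.closedBall (0 : EuclideanSpace ℝ (Fin (n + 1))) 1 := fun x => by
    simpa using norm_radialRetraction_le x
  have hd : ∀ x y, ‖x - y‖ ≤ 1 → dist (dilatedExtension f R x) (dilatedExtension f R y)
      ≤ ε * (2 * L / R) ^ α := by
    intro x y hxy
    have h1 : dist (radialRetraction (WithLp.toLp 2 (R⁻¹ • x) : EuclideanSpace ℝ (Fin (n + 1))))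
        (radialRetraction (WithLp.toLp 2 (R⁻¹ • y))) ≤ 2 * L / R := by
      rw [dist_eq_norm]
      refine (norm_radialRetraction_sub_le _ _).trans ?_
      rw [← WithLp.toLp_sub, ← smul_sub]
      refine (mul_le_mul_of_nonneg_left (hLn _) (by norm_num)).trans ?_
      rw [norm_smul, norm_inv, Real.norm_of_nonneg hR.le]
      calc 2 * (L * (R⁻¹ * ‖x - y‖)) = 2 * L / R * ‖x - y‖ := by ring
        _ ≤ 2 * L / R := mul_le_of_le_one_right (by positivity) hxy
    refine (hf _ (hmem _) _ (hmem _) (h1.trans hRr)).trans ?_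
    exact mul_le_mul_of_nonneg_left (Real.rpow_le_rpow dist_nonneg h1 hα.le) hε
  refine ⟨fun k => (continuous_apply k).comp (continuous_fst.comp hc), continuous_snd.comp hc,
    fun x => hM _ (hmem _), fun k x y hxy => ?_, fun x y hxy => ?_⟩
  · exact (abs_heisenbergCoords_sub_le _ _ k).trans (hd x y hxy)
  · exact (abs_heisenbergCoords_vertical_le _ _).trans
      (pow_le_pow_left₀ dist_nonneg (hd x y hxy) 2)

theorem radialRetraction_of_one_le {E : Type*} [NormedAddCommGroup E] [NormedSpace ℝ E] {x : E}
    (hx : 1 ≤ ‖x‖) : ‖radialRetraction x‖ = 1 ∧ x = ‖x‖ • radialRetraction x := by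
  have h0 : ‖x‖ ≠ 0 := by linarith
  rw [radialRetraction, max_eq_right hx]
  refine ⟨by rw [norm_smul, norm_inv, norm_norm, inv_mul_cancel₀ h0], ?_⟩
  rw [smul_smul, mul_inv_cancel₀ h0, one_smul]

set_option maxHeartbeats 1000000 in
/-- There is no map of the ball satisfying the small Hölder condition at the critical exponent that
is injective on the sphere. -/
theorem not_injOn_sphere_of_holder (f : EuclideanSpace ℝ (Fin (n + 1)) → HeisenbergGroup n)
    (hf : ∀ ε > 0, ∃ r > 0, ∀ x ∈ Metric.closedBall (0 : EuclideanSpace ℝ (Fin (n + 1))) 1,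
      ∀ y ∈ Metric.closedBall (0 : EuclideanSpace ℝ (Fin (n + 1))) 1,
        dist x y ≤ r → dist (f x) (f y) ≤ ε * dist x y ^ (((n : ℝ) + 1) / ((n : ℝ) + 2))) :
    ¬ Set.InjOn f (Metric.sphere 0 1) := by
  intro hinj
  set α : ℝ := ((n : ℝ) + 1) / ((n : ℝ) + 2) with hαdef
  have hα : 0 < α := by positivity
  have hfc : ContinuousOn f (Metric.closedBall 0 1) := by
    obtain ⟨r, hr, h⟩ := hf 1 one_pos
    exact continuousOn_of_holder hα hr h
  obtain ⟨M, hM⟩ := (isCompact_closedBall (0 : EuclideanSpace ℝ (Fin (n + 1))) 1)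
    |>.exists_bound_of_continuousOn (continuous_heisenbergCoords.comp_continuousOn hfc)
  have hM0 : 0 ≤ M := (norm_nonneg _).trans (hM 0 (by simp))
  obtain ⟨L, hL, hLn⟩ := exists_norm_toLp_le (n + 1)
  -- approximate inverse of `f` on the sphere
  have hP : ∀ i : Fin (n + 1), ∃ P : (Fin n ⊕ Fin n → ℝ) × ℝ → ℝ, ContDiff ℝ ∞ P ∧
      ∀ s : EuclideanSpace ℝ (Fin (n + 1)), ‖s‖ = 1 →
        |P (heisenbergCoords (f s)) - ((n : ℝ) + 1) * s i| < 1 / 4 := by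
    intro i
    have hcont : Continuous fun s : Metric.sphere (0 : EuclideanSpace ℝ (Fin (n + 1))) 1 =>
        heisenbergCoords (f s) :=
      continuous_heisenbergCoords.comp
        (hfc.comp_continuous continuous_subtype_val fun s => Metric.sphere_subset_closedBall s.2)
    obtain ⟨P, hP, h⟩ := exists_contDiff_comp_near hcont
      (fun s s' hss => Subtype.ext (hinj s.2 s'.2 (heisenbergCoords_injective hss)))
      (fun o : Option (Fin n ⊕ Fin n) => o.elim (ContinuousLinearMap.snd ℝ _ ℝ)
        fun k => (ContinuousLinearMap.proj k).comp (ContinuousLinearMap.fst ℝ _ ℝ))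
      (fun v w hvw => Prod.ext (funext fun k => hvw (some k)) (hvw none))
      (τ := fun s => ((n : ℝ) + 1) * (s : EuclideanSpace ℝ (Fin (n + 1))) i)
      (by fun_prop) (show (0 : ℝ) < 1 / 4 by norm_num)
    exact ⟨P, hP, fun s hs => h ⟨s, by simpa using hs⟩⟩
  choose P hPd hP using hP
  -- The radius is the bound for the mollified coordinates, so it covers the map before and after
  -- mollification.
  obtain ⟨ρ, hρ, hPu⟩ := exists_uniform_delta (fun i => (hPd i).continuous)
    (M + (1 + 4 * n * M)) (show (0 : ℝ) < 1 / 4 by norm_num)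
  obtain ⟨K, hK0, hK⟩ := exists_bound_integral_jac (fun i w => smoothStep (P i w))
    (fun i => contDiff_smoothStep.comp (hPd i)) (M + (1 + 4 * n * M))
  -- choice of the small constant
  set C : ℝ := (1 + mollConst (n + 1)) * (1 + 4 * n) with hCdef
  have hC : 0 ≤ C := mul_nonneg (by linarith [mollConst_nonneg (n + 1)]) (by positivity)
  set B : ℝ := K * (C ^ (n + 2) * (2 * L) ^ (n + 1)) with hB
  have hB0 : 0 ≤ B := by positivity
  set ε : ℝ := 1 / (B + 1) with hε
  have hε0 : 0 < ε := by positivity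
  have hε1 : ε ≤ 1 := by rw [hε, div_le_one (by positivity)]; linarith
  obtain ⟨r, hr, hfr⟩ := hf ε hε0
  -- choice of the large radius
  have hlim : Tendsto (fun R : ℝ => 2 * L / R) atTop (𝓝 0) := tendsto_const_nhds.div_atTop tendsto_id
  have hlim2 : Tendsto (fun R : ℝ => ε * (2 * L / R) ^ α) atTop (𝓝 0) := by
    have := (hlim.rpow_const (p := α) (Or.inr hα.le)).const_mul ε
    rwa [Real.zero_rpow hα.ne', mul_zero] at this
  have hlim3 : Tendsto (fun R : ℝ => C * (ε * (2 * L / R) ^ α)) atTop (𝓝 0) := by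
    simpa using hlim2.const_mul C
  have hlim4 : Tendsto (fun R : ℝ => (1 + 4 * n * M) * (ε * (2 * L / R) ^ α)) atTop (𝓝 0) := by
    simpa using hlim2.const_mul (1 + 4 * n * M)
  obtain ⟨R, hR1, hR2, hR3, hR4, hRn⟩ := ((hlim.eventually (ge_mem_nhds hr)).and
    ((hlim2.eventually (ge_mem_nhds one_pos)).and ((hlim3.eventually (ge_mem_nhds one_pos)).and
      ((hlim4.eventually (gt_mem_nhds hρ)).and (eventually_ge_atTop ((n : ℝ) + 1)))))).exists
  have hR : 0 < R := lt_of_lt_of_le (by positivity) hRn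
  set δ : ℝ := ε * (2 * L / R) ^ α with hδ
  have hδ0 : 0 ≤ δ := by positivity
  have hosc := heisenbergOsc_dilatedExtension hα hε0.le hL hR hfc hM hLn hfr hR1
  set z : Fin n ⊕ Fin n → (Fin (n + 1) → ℝ) → ℝ :=
    fun k x => (heisenbergCoords (dilatedExtension f R x)).1 k with hz
  set t : (Fin (n + 1) → ℝ) → ℝ := fun x => (heisenbergCoords (dilatedExtension f R x)).2 with ht
  have hV := hosc.almostHorizontal hδ0 hR2
  have hclose := hosc.norm_mollify_sub_le hδ0 hR2
  have hPclose : ∀ i x, |P i (fun k => mollify (z k) x, mollify t x)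
      - P i (heisenbergCoords (dilatedExtension f R x))| < 1 / 4 := by
    intro i x
    refine hPu i _ _ (hV.norm_le x) ((hosc.norm_le x).trans ?_) ((hclose x).trans_lt hR4)
    have : 0 ≤ 4 * n * M := by positivity
    linarith
  have hout : ∀ x, R ≤ ‖x‖ → ∃ i,
      (1 / 2 < P i (fun k => mollify (z k) x, mollify t x) ∧ 1 / 2 < x i) ∨
      (P i (fun k => mollify (z k) x, mollify t x) < -(1 / 2) ∧ x i < -(1 / 2)) := by
    intro x hx
    set y : EuclideanSpace ℝ (Fin (n + 1)) := WithLp.toLp 2 (R⁻¹ • x) with hy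
    have hy1 : 1 ≤ ‖y‖ := by
      refine le_trans ?_ (norm_le_norm_toLp (R⁻¹ • x))
      rw [norm_smul, norm_inv, Real.norm_of_nonneg hR.le, ← div_eq_inv_mul]
      exact (one_le_div hR).2 hx
    obtain ⟨hs1, hs2⟩ := radialRetraction_of_one_le hy1
    obtain ⟨i, hi⟩ := exists_one_le_mul_abs_of_norm_eq_one hs1
    have h1 := abs_lt.1 (hP i _ hs1)
    have h2 := abs_lt.1 (hPclose i x)
    change -(1 / 4) < P i _ - P i (heisenbergCoords (f (radialRetraction y))) ∧
      P i _ - P i (heisenbergCoords (f (radialRetraction y))) < 1 / 4 at h2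
    have hxi : x i = R * ‖y‖ * radialRetraction y i := by
      have h3 : y i = ‖y‖ * radialRetraction y i := by
        conv_lhs => rw [hs2]
        simp
      have h4 : y i = R⁻¹ * x i := by simp [hy]
      rw [mul_assoc, ← h3, h4, mul_inv_cancel_left₀ hR.ne']
    -- With `R ≥ n + 1` the coordinate `x i` has absolute value at least 1 and the sign of the
    -- retracted coordinate.
    have hRy : (n : ℝ) + 1 ≤ R * ‖y‖ := hRn.trans (le_mul_of_one_le_right hR.le hy1)
    refine ⟨i, ?_⟩
    have hn1 : (0 : ℝ) < n + 1 := by positivity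
    rcases le_abs.1 hi with hi | hi
    · refine Or.inl ⟨by linarith, ?_⟩
      have h5 : 0 < radialRetraction y i := by
        by_contra! hneg
        nlinarith
      rw [hxi]
      nlinarith
    · refine Or.inr ⟨by linarith, ?_⟩
      have h5 : radialRetraction y i < 0 := by
        by_contra! hneg
        nlinarith
      rw [hxi]
      nlinarith
  have hPV : ∀ i, ContDiff ℝ ∞ fun x => P i (fun k => mollify (z k) x, mollify t x) := fun i =>
    (hPd i).comp (contDiff_coords hV.contDiff_z hV.contDiff_t)
  have hdeg : ∫ x, jac (fun i x => smoothStep (P i (fun k => mollify (z k) x, mollify t x))) x = 1 :=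
    integral_jac_smoothStep_eq_one
      (h := fun i x => P i (fun k => mollify (z k) x, mollify t x)) hPV hR.le hout
  have hsmall := hK (fun k => mollify (z k)) (mollify t) (C * δ) R (by positivity) hR3 hR.le hV fun x hx => by
    obtain ⟨i, hi⟩ := hout x hx
    have hi' : 1 / 2 < |P i (fun k => mollify (z k) x, mollify t x)| := by
      rcases hi with hi | hi
      · exact lt_abs.2 (Or.inl hi.1)
      · exact lt_abs.2 (Or.inr (by linarith [hi.1]))
    exact ⟨i, fderiv_smoothStep_comp_eq_zero ((hPd i).differentiable (by simp) _) hi'⟩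
  rw [hdeg, abs_one] at hsmall
  -- Criticality of the exponent: `α (n + 2) = n + 1`, so all powers of `R` cancel. The bound `B * ε
  -- ^ (n + 2)` is then below 1 by the choice of `ε`.
  have hpow : ((2 * L / R) ^ α) ^ (n + 2) * R ^ (n + 1) = (2 * L) ^ (n + 1) := by
    have h0 : 0 ≤ 2 * L / R := by positivity
    rw [← Real.rpow_natCast, ← Real.rpow_mul h0]
    have : α * ((n + 2 : ℕ) : ℝ) = ((n + 1 : ℕ) : ℝ) := by
      rw [hαdef]
      push_cast
      field_simp
    rw [this, Real.rpow_natCast, ← mul_pow, div_mul_cancel₀ _ hR.ne']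
  have hfinal : K * ((C * δ) ^ (n + 2) * R ^ (n + 1)) = B * ε ^ (n + 2) := by
    rw [hB, hδ, mul_pow, mul_pow, ← hpow]
    ring
  rw [hfinal] at hsmall
  have h1 : ε ^ (n + 2) ≤ ε := pow_le_of_le_one hε0.le hε1 (by simp)
  have h2 : B * ε < 1 := by
    rw [hε, mul_one_div, div_lt_one (by positivity)]
    linarith
  linarith [mul_le_mul_of_nonneg_left h1 hB0]

end Extension

theorem corollary3 (m n : ℕ) (hmn : n + 1 ≤ m) :
    ¬ ∃ f : EuclideanSpace ℝ (Fin m) → HeisenbergGroup n,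
      HolderPlusOn (((n : ℝ) + 1) / ((n : ℝ) + 2)) f
        (Metric.closedBall (0 : EuclideanSpace ℝ (Fin m)) 1) ∧
      Topology.IsEmbedding
        (Set.domRestrict (Metric.sphere (0 : EuclideanSpace ℝ (Fin m)) 1) f) := by
  rintro ⟨f, hf, hemb⟩
  -- Restriction to an (n+1)-dimensional subspace preserves the Hölder condition and injectivity on
  -- the unit sphere, which is all that the embedding has to provide.
  obtain ⟨J⟩ := exists_linearIsometry_euclideanSpace hmn
  refine not_injOn_sphere_of_holder (fun x => f (J x)) (fun ε hε => ?_) fun x hx y hy hxy => ?_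
  · obtain ⟨r, hr, h⟩ := hf.exists_dist_le hε
    refine ⟨r, hr, fun x hx y hy hxy => ?_⟩
    have := h (J x) (by simpa using hx) (J y) (by simpa using hy) (by rwa [J.dist_map])
    rwa [J.dist_map] at this
  · have hx' : J x ∈ Metric.sphere (0 : EuclideanSpace ℝ (Fin m)) 1 := by simpa using hx
    have hy' : J y ∈ Metric.sphere (0 : EuclideanSpace ℝ (Fin m)) 1 := by simpa using hy
    have := hemb.injective (a₁ := ⟨J x, hx'⟩) (a₂ := ⟨J y, hy'⟩) hxy
    exact J.injective (congrArg Subtype.val this)
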